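/- A geometry $(G,I,O)$ consists of a finite simple graph $G$ and sets $I,O\subseteq V(G)$. Write $O^c=V(G)\setminus O$, $I^c=V(G)\setminus I$, and $x\sim y$ for adjacency. A flow on $(G,I,O)$ is a pair $(f,\preceq)$ of a function $f:O^c\to I^c$ and a partial order $\preceq$ on $V(G)$ such that, for all $x\in O^c$ and $y\in V(G)$: (i) $x\sim f(x)$; (ii) $x\preceq f(x)$; (iii) $y\sim f(x)$ implies $x\preceq y$. The natural pre-order for $f$ is the reflexive and transitive closure of the relations (ii) and (iii). Theorem. There are a single algorithm for a random access machine (with registers and finitely many zero-initialised arrays, addition, truncated subtraction, multiplication and comparison at unit cost, and words of $O(\log (n+2))$ bits) and a constant $C$ with the following property. Let $(G,I,O)$ be a geometry with $V(G)=\{0,\dots,n-1\}$, $|I|=|O|=k$ and $|E(G)|=m$. The input consists of $n$, $k$, the adjacency lists of $G$ (concatenated in one array, with an array of their starting positions), and lists of the elements of $I$ and of $O$, all in arbitrary order. Then the algorithm halts and reports correctly whether $(G,I,O)$ has a flow. If it has one, the algorithm also outputs a flow $(f,\preceq)$ for which $\preceq$ is the natural pre-order for $f$. Here $f$ is given as an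 array, and $\preceq$ as a chain decomposition: for each vertex, the number of the path $v, f(v), f(f(v)),\dots$ with $v\in I$ that contains it and its position in that path; and for each $x\in V(G)$ and each such path $P$, the first vertex $y$ of $P$ with $x\preceq y$, or the information that there is none. The running time is at most $C\,(km+k+1)$, and also at most $C\,(k^2n+1)$. In particular it is $O(km)$ for all $k,m\ge 1$, and $O(k^2n)$ for all $k\ge 1$. -/

import Mathlib

/-! ### Geometries and flows -/

/-- `(f, le)` is a flow on the geometry `(G, I, O)`: `le` is a partial order on the vertices and
`f : Oᶜ → Iᶜ` satisfies the three flow conditions. -/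
structure IsFlow {V : Type*} (G : SimpleGraph V) (I O : Finset V)
    (f : {x : V // x ∉ O} → {x : V // x ∉ I}) (le : V → V → Prop) : Prop where
  refl : ∀ x, le x x
  trans : ∀ x y z, le x y → le y z → le x z
  antisymm : ∀ x y, le x y → le y x → x = y
  adj_succ : ∀ x : {x : V // x ∉ O}, G.Adj x (f x)
  le_succ : ∀ x : {x : V // x ∉ O}, le x (f x)
  le_of_adj_succ : ∀ (x : {x : V // x ∉ O}) (y : V), G.Adj y (f x) → le x y

/-- The geometry `(G, I, O)` has a flow. -/
def HasFlow {V : Type*} (G : SimpleGraph V) (I O : Finset V) : Prop :=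
  ∃ (f : {x : V // x ∉ O} → {x : V // x ∉ I}) (le : V → V → Prop), IsFlow G I O f le

/-- The natural pre-order for `f`: the reflexive and transitive closure of the relations
`x ≼ f x` and `x ≼ y` for `y ∼ f x`. -/
def naturalLE {V : Type*} (G : SimpleGraph V) (I O : Finset V)
    (f : {x : V // x ∉ O} → {x : V // x ∉ I}) : V → V → Prop :=
  Relation.ReflTransGen fun x y =>
    ∃ hx : x ∉ O, y = (f ⟨x, hx⟩ : V) ∨ G.Adj y (f ⟨x, hx⟩ : V)

/-! ### A random access machine with a step count

Programs are structured programs over registers and finitely many integer arrays with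
random access.  Every evaluation of a node of an expression, every assignment, every store and
every test costs one time unit.  All numbers that a program computes must be smaller than a
word bound `W`; a computation that exceeds it has no execution. -/

namespace RAM

/-- The memory: registers `reg r`, and arrays `mem a` with cells `mem a i`. -/
structure State where
  reg : ℕ → ℕ
  mem : ℕ → ℕ → ℕ

/-- Expressions; `lt` yields `1` or `0`, and `sub` is truncated subtraction. -/
inductive Expr where
  | lit (c : ℕ)
  | reg (r : ℕ)
  | load (a : ℕ) (i : Expr)
  | add (e₁ e₂ : Expr)
  | sub (e₁ e₂ : Expr)
  | mul (e₁ e₂ : Expr)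
  | lt (e₁ e₂ : Expr)

namespace Expr

/-- The value of an expression. -/
def val (s : State) : Expr → ℕ
  | lit c => c
  | reg r => s.reg r
  | load a i => s.mem a (i.val s)
  | add e₁ e₂ => e₁.val s + e₂.val s
  | sub e₁ e₂ => e₁.val s - e₂.val s
  | mul e₁ e₂ => e₁.val s * e₂.val s
  | lt e₁ e₂ => if e₁.val s < e₂.val s then 1 else 0

/-- All values that occur in the evaluation of an expression are smaller than `W`. -/
def Fits (W : ℕ) (s : State) : Expr → Prop
  | lit c => c < W
  | reg r => s.reg r < W
  | load a i => i.Fits W s ∧ s.mem a (i.val s) < W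
  | add e₁ e₂ => e₁.Fits W s ∧ e₂.Fits W s ∧ e₁.val s + e₂.val s < W
  | sub e₁ e₂ => e₁.Fits W s ∧ e₂.Fits W s
  | mul e₁ e₂ => e₁.Fits W s ∧ e₂.Fits W s ∧ e₁.val s * e₂.val s < W
  | lt e₁ e₂ => e₁.Fits W s ∧ e₂.Fits W s ∧ 1 < W

/-- The time to evaluate an expression: its number of nodes. -/
def cost : Expr → ℕ
  | lit _ => 1
  | reg _ => 1
  | load _ i => i.cost + 1
  | add e₁ e₂ => e₁.cost + e₂.cost + 1
  | sub e₁ e₂ => e₁.cost + e₂.cost + 1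
  | mul e₁ e₂ => e₁.cost + e₂.cost + 1
  | lt e₁ e₂ => e₁.cost + e₂.cost + 1

end Expr

/-- Programs.  A test `e` succeeds if its value is not zero. -/
inductive Prog where
  | skip
  | assign (r : ℕ) (e : Expr)
  | store (a : ℕ) (i e : Expr)
  | seq (p q : Prog)
  | ite (e : Expr) (p q : Prog)
  | loop (e : Expr) (p : Prog)

/-- Overwrite a register. -/
def State.setReg (s : State) (r v : ℕ) : State :=
  { s with reg := Function.update s.reg r v }

/-- Overwrite an array cell. -/
def State.setMem (s : State) (a i v : ℕ) : State :=
  { s with mem := Function.update s.mem a (Function.update (s.mem a) i v) }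

/-- `Exec W p s t s'`: started in state `s`, the program `p` halts after exactly `t` time units
in state `s'`, and all values that occur are smaller than `W`. -/
inductive Exec (W : ℕ) : Prog → State → ℕ → State → Prop where
  | skip (s : State) : Exec W .skip s 1 s
  | assign (s : State) (r : ℕ) (e : Expr) (he : e.Fits W s) :
      Exec W (.assign r e) s (e.cost + 1) (s.setReg r (e.val s))
  | store (s : State) (a : ℕ) (i e : Expr) (hi : i.Fits W s) (he : e.Fits W s) :
      Exec W (.store a i e) s (i.cost + e.cost + 1) (s.setMem a (i.val s) (e.val s))
  | seq {p q : Prog} {s s' s'' : State} {t t' : ℕ}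
      (hp : Exec W p s t s') (hq : Exec W q s' t' s'') : Exec W (.seq p q) s (t + t') s''
  | iteTrue {e : Expr} {p q : Prog} {s s' : State} {t : ℕ} (he : e.Fits W s)
      (h : e.val s ≠ 0) (hp : Exec W p s t s') : Exec W (.ite e p q) s (e.cost + 1 + t) s'
  | iteFalse {e : Expr} {p q : Prog} {s s' : State} {t : ℕ} (he : e.Fits W s)
      (h : e.val s = 0) (hq : Exec W q s t s') : Exec W (.ite e p q) s (e.cost + 1 + t) s'
  | loopTrue {e : Expr} {p : Prog} {s s' s'' : State} {t t' : ℕ} (he : e.Fits W s)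
      (h : e.val s ≠ 0) (hp : Exec W p s t s') (hl : Exec W (.loop e p) s' t' s'') :
      Exec W (.loop e p) s (e.cost + 1 + t + t') s''
  | loopFalse {e : Expr} {p : Prog} {s : State} (he : e.Fits W s)
      (h : e.val s = 0) : Exec W (.loop e p) s (e.cost + 1) s

/-- Executions are deterministic: the running time and the final state are unique. -/
theorem Exec.unique {W : ℕ} {p : Prog} {s s₁ s₂ : State} {t₁ t₂ : ℕ}
    (h₁ : Exec W p s t₁ s₁) (h₂ : Exec W p s t₂ s₂) : t₁ = t₂ ∧ s₁ = s₂ := by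
  induction h₁ generalizing t₂ s₂ <;> cases h₂ <;> grind

end RAM

/-! ### Input and output formats -/

/-- `adj v` lists the neighbours of `v`, `inp` lists `I` and `out` lists `O`, in any order but
without repetitions. -/
structure IsPresentation {n : ℕ} (G : SimpleGraph (Fin n)) (I O : Finset (Fin n))
    (adj : Fin n → List (Fin n)) (inp out : List (Fin n)) : Prop where
  nodup_adj : ∀ v, (adj v).Nodup
  mem_adj : ∀ v w, w ∈ adj v ↔ G.Adj v w
  nodup_inp : inp.Nodup
  mem_inp : ∀ v, v ∈ inp ↔ v ∈ I
  nodup_out : out.Nodup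
  mem_out : ∀ v, v ∈ out ↔ v ∈ O

/-- The initial memory.  Register `0` holds the number `n` of vertices and register `1` the
number of input vertices.  Array `1` holds the concatenation of the adjacency lists of the
vertices `0, …, n - 1`, and cell `i ≤ n` of array `0` the position at which the list of vertex `i`
starts (for `i = n`: the total length).  Arrays `2` and `3` list the input and the output
vertices.  All other registers and cells are `0`. -/
def initialState {n : ℕ} (adj : Fin n → List (Fin n)) (inp out : List (Fin n)) : RAM.State where
  reg
    | 0 => n
    | 1 => inp.length
    | _ => 0
  mem
    | 0, i => if i ≤ n then ∑ v : Fin n, if v.val < i then (adj v).length else 0 else 0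
    | 1, i => (((List.finRange n).flatMap adj).map Fin.val).getD i 0
    | 2, i => (inp.map Fin.val).getD i 0
    | 3, i => (out.map Fin.val).getD i 0
    | _, _ => 0

/-- The memory `s` holds the function `f` and the relation `le`, the latter as a chain
decomposition along the paths `v, f v, f (f v), …` that start at the vertices `v` in `inp`.

* Array `4` holds `f`.
* Array `5` holds for each vertex the number of its path, where path `p` is the one that starts at
  the vertex `inp[p]`; array `6` holds the position of each vertex in its path.
* Cell `x * k + p` of array `7`, where `k` is the number of paths, holds `y + 1` if `y` is the
  first vertex of path `p` with `le x y`, and `0` if there is no such vertex. -/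
structure HoldsFlow {n : ℕ} (I O : Finset (Fin n)) (inp : List (Fin n)) (s : RAM.State)
    (f : {x : Fin n // x ∉ O} → {x : Fin n // x ∉ I}) (le : Fin n → Fin n → Prop) : Prop where
  succ : ∀ x : {x : Fin n // x ∉ O}, s.mem 4 x.1 = (f x).1
  path_lt : ∀ x : Fin n, s.mem 5 x < inp.length
  path_start : ∀ p : Fin inp.length, s.mem 5 inp[p] = p ∧ s.mem 6 inp[p] = 0
  path_succ : ∀ x : {x : Fin n // x ∉ O},
    s.mem 5 (f x).1 = s.mem 5 x.1 ∧ s.mem 6 (f x).1 = s.mem 6 x.1 + 1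
  table_some : ∀ (x : Fin n) (p : Fin inp.length) (y : Fin n),
    s.mem 7 (x * inp.length + p) = y + 1 ↔
      s.mem 5 y = p ∧ le x y ∧ ∀ z : Fin n, s.mem 5 z = p → le x z → s.mem 6 y ≤ s.mem 6 z
  table_none : ∀ (x : Fin n) (p : Fin inp.length),
    s.mem 7 (x * inp.length + p) = 0 ↔ ∀ y : Fin n, s.mem 5 y = p → ¬ le x y

/-!
Processed vertices are collected backwards from `O`.  The relations `x ≼ f x` and `x ≼ y` for
`y ∼ f x` say exactly that `x` may be processed as soon as `f x` and all other neighbours of `f x`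
have been.  So the greedy rule is: if a processed vertex `v ∉ I` has exactly one unprocessed
neighbour `u`, put `f u = v` and process `u`.  If all vertices get processed, then `f` is the
function of a flow, since the reverse of the processing order makes the natural pre-order
antisymmetric (`Schedule.isFlow`).  If there is some flow `(f, ≼)` and there are unprocessed
vertices, then for a `≼`-maximal such vertex `u` the vertex `f u` is a processed vertex whose only
unprocessed neighbour is `u`, so the rule does not get stuck (`Schedule.exists_next`).

A processed vertex that is a value of `f` has no unprocessed neighbour.  The others are kept in a
frontier of `k` cells, in which `u` takes the place of `v`; it is searched for a suitable `v` in each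
of the at most `n - k` stages, using the number of processed neighbours of each vertex
(`RAM.WP.stages`).

The numbers of the paths are then carried along `f`, in reverse processing order
(`RAM.WP.labelPaths`).  In processing order, the row of `x ∉ O` in the table of first vertices is the
minimum of the rows of `f x` and of the neighbours of `f x`, together with `x` itself
(`RAM.WP.fillTable`).  As `f` is injective, this merges at most `2m + (n - k)` rows of length `k`.

The bounds on the running time use two inequalities for a geometry with a flow: `n - k ≤ m`, because
the edges `x f(x)` are distinct (`IsFlow.card_le`), and `m ≤ k n`, because in a linear extension
every vertex has at most `k` later neighbours (`IsFlow.edges_le`).  Both are tested first, so that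
the rest of the algorithm may rely on them.

The correctness of the program is derived in a calculus of weakest preconditions with a time
counter (`RAM.WP`); what a program does not write syntactically is known to be unchanged
(`RAM.Exec.frame`).

The input, in registers `0` and `1` and arrays `0` to `3`, is not overwritten before the answer is
stored in register `0`.  Arrays `4` to `7` receive the output.  Arrays `8` and `9` hold, for each
vertex, whether it has been processed and how many of its neighbours have been; array `10` holds the
frontier, array `11` flags the inputs, and array `12` lists the vertices in processing order.
-/

/-! ### Weakest preconditions with time -/

namespace RAM

@[simp] theorem State.setReg_reg (s : State) (r v r' : ℕ) :
    (s.setReg r v).reg r' = if r' = r then v else s.reg r' := by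
  simp [State.setReg, Function.update_apply]

@[simp] theorem State.setReg_mem (s : State) (r v : ℕ) : (s.setReg r v).mem = s.mem := rfl

@[simp] theorem State.setMem_reg (s : State) (a i v : ℕ) : (s.setMem a i v).reg = s.reg := rfl

@[simp] theorem State.setMem_mem (s : State) (a i v a' : ℕ) :
    (s.setMem a i v).mem a' = if a' = a then Function.update (s.mem a) i v else s.mem a' := by
  simp [State.setMem, Function.update_apply]

theorem Expr.val_lt_ne_zero_iff {s : State} {e₁ e₂ : Expr} :
    (Expr.lt e₁ e₂).val s ≠ 0 ↔ e₁.val s < e₂.val s := by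
  rw [Expr.val]; split <;> simp_all

theorem Expr.val_lt_eq_zero_iff {s : State} {e₁ e₂ : Expr} :
    (Expr.lt e₁ e₂).val s = 0 ↔ e₂.val s ≤ e₁.val s := by
  rw [Expr.val]; split <;> simp_all

/-- The registers that a program assigns. -/
def Prog.regs : Prog → List ℕ
  | .skip => []
  | .assign r _ => [r]
  | .store _ _ _ => []
  | .seq p q => p.regs ++ q.regs
  | .ite _ p q => p.regs ++ q.regs
  | .loop _ p => p.regs

/-- The arrays that a program stores into. -/
def Prog.arrays : Prog → List ℕ
  | .skip => []
  | .assign _ _ => []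
  | .store a _ _ => [a]
  | .seq p q => p.arrays ++ q.arrays
  | .ite _ p q => p.arrays ++ q.arrays
  | .loop _ p => p.arrays

/-- `s` and `s'` differ at most in registers and arrays that `p` writes. -/
structure Frame (p : Prog) (s s' : State) : Prop where
  reg : ∀ r, r ∉ p.regs → s'.reg r = s.reg r
  mem : ∀ a, a ∉ p.arrays → s'.mem a = s.mem a

theorem Frame.refl (p : Prog) (s : State) : Frame p s s := ⟨fun _ _ => rfl, fun _ _ => rfl⟩

theorem Frame.trans {p : Prog} {s s' s'' : State} (h : Frame p s s') (h' : Frame p s' s'') :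
    Frame p s s'' :=
  ⟨fun r hr => (h'.reg r hr).trans (h.reg r hr), fun a ha => (h'.mem a ha).trans (h.mem a ha)⟩

theorem Frame.mono {p q : Prog} {s s' : State} (h : Frame p s s') (hr : p.regs ⊆ q.regs)
    (ha : p.arrays ⊆ q.arrays) : Frame q s s' :=
  ⟨fun r h' => h.reg r fun h'' => h' (hr h''), fun a h' => h.mem a fun h'' => h' (ha h'')⟩

/-- An execution changes only what the program writes syntactically. -/
theorem Exec.frame {W : ℕ} {p : Prog} {s s' : State} {t : ℕ} (h : Exec W p s t s') :
    Frame p s s' := by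
  induction h with
  | skip s => exact .refl _ _
  | assign s r e he => exact ⟨fun r' hr => by simp_all [Prog.regs], fun _ _ => rfl⟩
  | store s a i e hi he => exact ⟨fun _ _ => rfl, fun a' ha => by simp_all [Prog.arrays]⟩
  | seq hp hq ihp ihq =>
    exact (ihp.mono (by simp [Prog.regs]) (by simp [Prog.arrays])).trans
      (ihq.mono (by simp [Prog.regs]) (by simp [Prog.arrays]))
  | iteTrue he h hp ih => exact ih.mono (by simp [Prog.regs]) (by simp [Prog.arrays])
  | iteFalse he h hp ih => exact ih.mono (by simp [Prog.regs]) (by simp [Prog.arrays])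
  | loopTrue he h hp hl ihp ihl =>
    exact (ihp.mono (by simp [Prog.regs]) (by simp [Prog.arrays])).trans ihl
  | loopFalse he h => exact .refl _ _

/-- Weakest precondition: `p`, started in `s`, halts after some time `t` in a state `s'` such that
`Q t s'` holds. -/
def WP (W : ℕ) (p : Prog) (s : State) (Q : ℕ → State → Prop) : Prop :=
  ∃ t s', Exec W p s t s' ∧ Q t s'

namespace WP

variable {W : ℕ} {s : State} {Q : ℕ → State → Prop}

/-- The consequence rule; what `p` does not write stays as it is. -/
theorem conseq {p : Prog} {Q' : ℕ → State → Prop} (h : WP W p s Q')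
    (hQ : ∀ t s', Frame p s s' → Q' t s' → Q t s') : WP W p s Q := by
  obtain ⟨t, s', he, hq⟩ := h
  exact ⟨t, s', he, hQ t s' he.frame hq⟩

theorem skip_iff : WP W .skip s Q ↔ Q 1 s :=
  ⟨by rintro ⟨t, s', he, hq⟩; cases he; exact hq, fun h => ⟨_, _, .skip s, h⟩⟩

theorem assign_iff {r : ℕ} {e : Expr} : WP W (.assign r e) s Q ↔
    e.Fits W s ∧ Q (e.cost + 1) (s.setReg r (e.val s)) :=
  ⟨by rintro ⟨t, s', he, hq⟩; cases he with | assign _ _ _ he => exact ⟨he, hq⟩,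
    fun h => ⟨_, _, .assign s r e h.1, h.2⟩⟩

theorem store_iff {a : ℕ} {i e : Expr} : WP W (.store a i e) s Q ↔
    i.Fits W s ∧ e.Fits W s ∧ Q (i.cost + e.cost + 1) (s.setMem a (i.val s) (e.val s)) :=
  ⟨by rintro ⟨t, s', he, hq⟩; cases he with | store _ _ _ _ hi he => exact ⟨hi, he, hq⟩,
    fun h => ⟨_, _, .store s a i e h.1 h.2.1, h.2.2⟩⟩

theorem seq_iff {p q : Prog} : WP W (.seq p q) s Q ↔
    WP W p s fun t s' => WP W q s' fun t' s'' => Q (t + t') s'' := by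
  constructor
  · rintro ⟨t, s', he, hq⟩
    cases he with | seq hp hq' => exact ⟨_, _, hp, _, _, hq', hq⟩
  · rintro ⟨t, s', hp, t', s'', hq', hq⟩
    exact ⟨_, _, .seq hp hq', hq⟩

theorem ite_iff {e : Expr} {p q : Prog} : WP W (.ite e p q) s Q ↔
    e.Fits W s ∧ (e.val s ≠ 0 → WP W p s fun t s' => Q (e.cost + 1 + t) s') ∧
      (e.val s = 0 → WP W q s fun t s' => Q (e.cost + 1 + t) s') := by
  constructor
  · rintro ⟨t, s', he, hq⟩
    cases he with
    | iteTrue he h hp => exact ⟨he, fun _ => ⟨_, _, hp, hq⟩, fun h' => (h h').elim⟩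
    | iteFalse he h hp => exact ⟨he, fun h' => (h' h).elim, fun _ => ⟨_, _, hp, hq⟩⟩
  · rintro ⟨he, h₁, h₂⟩
    by_cases h : e.val s = 0
    · obtain ⟨t, s', hp, hq⟩ := h₂ h
      exact ⟨_, _, .iteFalse he h hp, hq⟩
    · obtain ⟨t, s', hp, hq⟩ := h₁ h
      exact ⟨_, _, .iteTrue he h hp, hq⟩

/-- The rule for a loop with `N` rounds.  The invariant `Inv i t s` speaks of the number `i` of
completed rounds and of the time `t` they have taken. -/
theorem loop {e : Expr} {p : Prog} (N : ℕ) (Inv : ℕ → ℕ → State → Prop) (h0 : Inv 0 0 s)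
    (hstep : ∀ i t s', i < N → Frame p s s' → Inv i t s' → e.Fits W s' ∧ e.val s' ≠ 0 ∧
      WP W p s' fun t' s'' => Inv (i + 1) (t + (e.cost + 1 + t')) s'')
    (hend : ∀ t s', Frame p s s' → Inv N t s' → e.Fits W s' ∧ e.val s' = 0)
    (hQ : ∀ t s', Frame p s s' → Inv N t s' → Q (t + (e.cost + 1)) s') :
    WP W (.loop e p) s Q := by
  suffices key : ∀ j i t s', i + j = N → Frame p s s' → Inv i t s' →
      ∃ t' s'', Exec W (.loop e p) s' t' s'' ∧ Q (t + t') s'' by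
    obtain ⟨t', s'', he, hq⟩ := key N 0 0 s (by simp) (.refl _ _) h0
    exact ⟨t', s'', he, by simpa using hq⟩
  intro j
  induction j with
  | zero =>
    intro i t s' hi hF hI
    obtain rfl : i = N := by simpa using hi
    obtain ⟨h₁, h₂⟩ := hend t s' hF hI
    exact ⟨_, _, .loopFalse h₁ h₂, hQ t s' hF hI⟩
  | succ j ih =>
    intro i t s' hi hF hI
    obtain ⟨h₁, h₂, t₁, s₁, he, hI'⟩ := hstep i t s' (by omega) hF hI
    obtain ⟨t₂, s₂, he₂, hq⟩ := ih (i + 1) _ s₁ (by omega) (hF.trans he.frame) hI'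
    exact ⟨_, _, .loopTrue h₁ h₂ he he₂, by rwa [← add_assoc] ⟩

end WP

/-- `for r < b do p`: the register `r` counts up, from its present value, to the value of
register `b`. -/
def forLoop (r b : ℕ) (p : Prog) : Prog :=
  .loop (.lt (.reg r) (.reg b)) (.seq p (.assign r (.add (.reg r) (.lit 1))))

/-- The rule for counting loops; each round costs `8` in addition to the body. -/
theorem WP.forLoop {W : ℕ} {s : State} {Q : ℕ → State → Prop} {r b : ℕ} {p : Prog}
    (lo hi : ℕ) (Inv : ℕ → ℕ → State → Prop)
    (hW : hi + 1 < W) (hr : r ∉ p.regs) (hb : b ∉ p.regs) (hrb : b ≠ r)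
    (hlo : s.reg r = lo) (hhi : s.reg b = hi) (hle : lo ≤ hi) (h0 : Inv lo 0 s)
    (hstep : ∀ i t s', lo ≤ i → i < hi → s'.reg r = i →
      Frame (.seq p (.assign r (.add (.reg r) (.lit 1)))) s s' → Inv i t s' →
      WP W p s' fun t' s'' => Inv (i + 1) (t + t' + 8) (s''.setReg r (i + 1)))
    (hQ : ∀ t s', Frame (.seq p (.assign r (.add (.reg r) (.lit 1)))) s s' → s'.reg r = hi →
      Inv hi t s' → Q (t + 4) s') :
    WP W (forLoop r b p) s Q := by
  have hb' : ∀ s', Frame (.seq p (.assign r (.add (.reg r) (.lit 1)))) s s' → s'.reg b = hi := by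
    intro s' hF
    rw [hF.reg b (by simp [Prog.regs, hb, hrb]), hhi]
  refine WP.loop (hi - lo) (fun i t s' => s'.reg r = lo + i ∧ Inv (lo + i) t s')
    ⟨by simpa using hlo, h0⟩ ?_ ?_ ?_
  · rintro i t s' hi hF ⟨hr', hI⟩
    have hbs := hb' s' hF
    refine ⟨by simp only [Expr.Fits]; omega, ?_, ?_⟩
    · rw [Expr.val_lt_ne_zero_iff]; simp only [Expr.val]; omega
    rw [WP.seq_iff]
    refine (hstep (lo + i) t s' (by omega) (by omega) hr' hF hI).conseq ?_
    intro t' s'' hF' hI'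
    have : s''.reg r = lo + i := by rw [hF'.reg r hr, hr']
    rw [WP.assign_iff]
    refine ⟨by simp only [Expr.Fits, Expr.val]; omega, ?_⟩
    simp only [Expr.val, Expr.cost, this]
    have ht : t + (1 + 1 + 1 + 1 + (t' + (1 + 1 + 1 + 1))) = t + t' + 8 := by omega
    rw [ht]
    exact ⟨by simp [add_assoc], hI'⟩
  · rintro t s' hF ⟨hr', hI⟩
    have hbs := hb' s' hF
    refine ⟨by simp only [Expr.Fits]; omega, ?_⟩
    rw [Expr.val_lt_eq_zero_iff]; simp only [Expr.val]; omega
  · rintro t s' hF ⟨hr', hI⟩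
    have hlh : lo + (hi - lo) = hi := by omega
    rw [hlh] at hI hr'
    exact hQ t s' hF hr' hI

end RAM

/-! ### Consequences of the existence of a flow -/

section Flow

variable {V : Type*} {G : SimpleGraph V} {I O : Finset V}

/-- The partial order of a flow. -/
@[reducible] def IsFlow.partialOrder {f : {x : V // x ∉ O} → {x : V // x ∉ I}} {le : V → V → Prop}
    (h : IsFlow G I O f le) : PartialOrder V where
  le := le
  le_refl := h.refl
  le_trans := h.trans
  le_antisymm := h.antisymm

/-- If `f x = f y`, then `x` and `y` are neighbours of both values, so `x ≼ y ≼ x`. -/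
theorem IsFlow.injective {f : {x : V // x ∉ O} → {x : V // x ∉ I}} {le : V → V → Prop}
    (h : IsFlow G I O f le) : Function.Injective f := by
  intro x y hxy
  refine Subtype.ext (h.antisymm _ _ (h.le_of_adj_succ x y ?_) (h.le_of_adj_succ y x ?_))
  · rw [hxy]; exact h.adj_succ y
  · rw [← hxy]; exact h.adj_succ x

/-- The edges `x f(x)` are distinct. -/
theorem IsFlow.card_le [Fintype V] {f : {x : V // x ∉ O} → {x : V // x ∉ I}} {le : V → V → Prop}
    (h : IsFlow G I O f le) : Fintype.card V ≤ G.edgeSet.ncard + O.card := by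
  classical
  have hinj : Function.Injective
      fun x : {x : V // x ∉ O} => (⟨s(x.1, (f x).1), h.adj_succ x⟩ : G.edgeSet) := by
    intro x y hxy
    have hxy' : s(x.1, (f x).1) = s(y.1, (f y).1) := congrArg Subtype.val hxy
    rw [Sym2.eq_iff] at hxy'
    rcases hxy' with h' | ⟨h₁, h₂⟩
    · exact Subtype.ext h'.1
    · have h₃ := h.le_succ x
      have h₄ := h.le_succ y
      rw [h₂] at h₃
      rw [← h₁] at h₄
      exact Subtype.ext (h.antisymm _ _ h₃ h₄)
  have h₁ := Nat.card_le_card_of_injective _ hinj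
  rw [Nat.card_eq_fintype_card, Fintype.card_subtype_compl, Fintype.card_coe] at h₁
  rw [Nat.card_coe_set_eq] at h₁
  omega

/-- In a linear extension of the order of a flow, `f` maps the vertices of `Oᶜ` that are later than
`x` injectively to vertices later than `x`, none of them a neighbour of `x`.  Hence `x` has at most
`|O|` later neighbours. -/
theorem IsFlow.edges_le [Fintype V] {f : {x : V // x ∉ O} → {x : V // x ∉ I}} {le : V → V → Prop}
    (h : IsFlow G I O f le) : G.edgeSet.ncard ≤ O.card * Fintype.card V := by
  classical
  let _ := h.partialOrder
  obtain ⟨r, hr, hle⟩ := extend_partialOrder (α := V) (· ≤ ·)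
  let U : V → Finset V := fun x => {y | r x y ∧ y ≠ x}
  let N : V → Finset V := fun x => {y | G.Adj x y ∧ r x y}
  have hN : ∀ x, (N x).card ≤ O.card := by
    intro x
    let A : Finset {z : V // z ∉ O} := {z | r x z ∧ z.1 ≠ x}
    let B : Finset V := A.image fun z => (f z).1
    have hB : B.card = A.card :=
      Finset.card_image_of_injective _ (Subtype.val_injective.comp h.injective)
    have hA : (U x \ O).card = A.card := by
      rw [← Finset.card_image_of_injective A Subtype.val_injective]
      congr 1
      ext z
      simp [U, A, and_assoc, and_comm]
    have hU : (U x).card ≤ (U x \ O).card + O.card := Finset.card_le_card_sdiff_add_card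
    have hdis : Disjoint (N x) B := by
      rw [Finset.disjoint_left]
      intro y hy hyB
      simp only [B, Finset.mem_image, A, Finset.mem_filter, Finset.mem_univ, true_and] at hyB
      obtain ⟨z, ⟨hz₁, hz₂⟩, rfl⟩ := hyB
      simp only [N, Finset.mem_filter, Finset.mem_univ, true_and] at hy
      exact hz₂ (hr.antisymm _ _ (hle _ _ (h.le_of_adj_succ z x hy.1)) hz₁)
    have hsub : N x ∪ B ⊆ U x := by
      intro y hy
      rw [Finset.mem_union] at hy
      simp only [U, Finset.mem_filter, Finset.mem_univ, true_and]
      rcases hy with hy | hyB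
      · simp only [N, Finset.mem_filter, Finset.mem_univ, true_and] at hy
        exact ⟨hy.2, hy.1.ne'⟩
      · simp only [B, Finset.mem_image, A, Finset.mem_filter, Finset.mem_univ, true_and] at hyB
        obtain ⟨z, ⟨hz₁, hz₂⟩, rfl⟩ := hyB
        have hzf := hle _ _ (h.le_succ z)
        refine ⟨hr.trans _ _ _ hz₁ hzf, fun he => hz₂ ?_⟩
        rw [he] at hzf
        exact hr.antisymm _ _ hzf hz₁
    have := Finset.card_le_card hsub
    rw [Finset.card_union_of_disjoint hdis] at this
    omega
  have hsurj : G.edgeSet ⊆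
      ((Finset.univ.sigma N).image fun p : (_ : V) × V => s(p.1, p.2) : Finset (Sym2 V)) := by
    intro e
    induction e with | _ x y =>
    intro he
    rw [SimpleGraph.mem_edgeSet] at he
    simp only [Finset.coe_image, Set.mem_image, Finset.mem_coe, Finset.mem_sigma,
      Finset.mem_univ, true_and, N, Finset.mem_filter]
    rcases hr.total x y with h' | h'
    · exact ⟨⟨x, y⟩, ⟨he, h'⟩, rfl⟩
    · exact ⟨⟨y, x⟩, ⟨he.symm, h'⟩, Sym2.eq_swap⟩
  calc G.edgeSet.ncard ≤ _ := Set.ncard_le_ncard hsurj (Finset.finite_toSet _)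
    _ ≤ (Finset.univ.sigma N).card := by rw [Set.ncard_coe_finset]; exact Finset.card_image_le
    _ = ∑ x, (N x).card := Finset.card_sigma _ _
    _ ≤ ∑ _x : V, O.card := Finset.sum_le_sum fun x _ => hN x
    _ = O.card * Fintype.card V := by simp [mul_comm]

end Flow

/-! ### Schedules -/

section Schedule

variable {V : Type*} {G : SimpleGraph V} {I O : Finset V} {F F' : V → V} {S : List V}

/-- The vertices in `S`, latest first, can be processed one after the other, once those of `O` have
been processed: when the turn of `u` comes, it is the only neighbour of the processed vertex
`F u ∉ I` which has not been processed. -/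
inductive Schedule (G : SimpleGraph V) (I O : Finset V) (F : V → V) : List V → Prop
  | nil : Schedule G I O F []
  | cons {u : V} {S : List V} (hS : Schedule G I O F S) (huO : u ∉ O) (huS : u ∉ S)
      (hF : F u ∈ S ∨ F u ∈ O) (hI : F u ∉ I) (hadj : G.Adj u (F u))
      (hnbr : ∀ y, G.Adj y (F u) → y ≠ u → y ∈ S ∨ y ∈ O) : Schedule G I O F (u :: S)

namespace Schedule

theorem nodup (h : Schedule G I O F S) : S.Nodup := by
  induction h with
  | nil => simp
  | cons hS huO huS _ _ _ _ ih => simp [huS, ih]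

theorem notMem_out (h : Schedule G I O F S) {x : V} (hx : x ∈ S) : x ∉ O := by
  induction h with
  | nil => simp at hx
  | cons hS huO huS _ _ _ _ ih =>
    rcases List.mem_cons.1 hx with rfl | hx
    · exact huO
    · exact ih hx

theorem congr (h : Schedule G I O F S) (hF : ∀ x ∈ S, F' x = F x) : Schedule G I O F' S := by
  induction h with
  | nil => exact .nil
  | cons hS huO huS hFu hI hadj hnbr ih =>
    rw [← hF _ List.mem_cons_self] at hFu hI hadj hnbr
    exact .cons (ih fun x hx => hF x (List.mem_cons_of_mem _ hx)) huO huS hFu hI hadj hnbr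

theorem succ_notMem_inp (h : Schedule G I O F S) {x : V} (hx : x ∈ S) : F x ∉ I := by
  induction h with
  | nil => simp at hx
  | cons hS huO huS hF hI _ _ ih =>
    rcases List.mem_cons.1 hx with rfl | hx
    · exact hI
    · exact ih hx

theorem adj_succ (h : Schedule G I O F S) {x : V} (hx : x ∈ S) : G.Adj x (F x) := by
  induction h with
  | nil => simp at hx
  | cons hS huO huS hF hI hadj _ ih =>
    rcases List.mem_cons.1 hx with rfl | hx
    · exact hadj
    · exact ih hx

theorem processed_of_step (h : Schedule G I O F S) {x y : V} (hx : x ∈ S)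
    (hy : y = F x ∨ G.Adj y (F x)) : y ∈ S ∨ y ∈ O := by
  induction h with
  | nil => simp at hx
  | cons hS huO huS hF hI hadj hnbr ih =>
    rw [List.mem_cons]
    rcases List.mem_cons.1 hx with rfl | hx
    · rcases hy with rfl | hy
      · tauto
      · have := hnbr y hy
        tauto
    · have := ih hx
      tauto

theorem succ_ne (h : Schedule G I O F S) {x : V} (hx : x ∈ S) : F x ≠ x :=
  (h.adj_succ hx).ne'

/-- If there is a flow, an incomplete schedule can be continued: a maximal vertex `u` among those
not processed is the only such neighbour of `f u`. -/
theorem exists_next [Finite V] (hflow : HasFlow G I O) (S : List V) (hS : ∃ x, x ∉ O ∧ x ∉ S) :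
    ∃ u v, u ∉ O ∧ u ∉ S ∧ (v ∈ S ∨ v ∈ O) ∧ v ∉ I ∧ G.Adj u v ∧
      ∀ y, G.Adj y v → y ≠ u → y ∈ S ∨ y ∈ O := by
  obtain ⟨f, le, hf⟩ := hflow
  let _ := hf.partialOrder
  obtain ⟨u, hu⟩ := (Set.toFinite {x | x ∉ O ∧ x ∉ S}).exists_maximal hS
  have hmax : ∀ y, le u y → y ≠ u → y ∈ S ∨ y ∈ O := by
    intro y huy hne
    by_contra hy
    exact hne (hf.antisymm _ _ (hu.2 (y := y) (by rw [not_or] at hy; exact ⟨hy.2, hy.1⟩) huy) huy)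
  have hadj := hf.adj_succ ⟨u, hu.1.1⟩
  exact ⟨u, f ⟨u, hu.1.1⟩, hu.1.1, hu.1.2, hmax _ (hf.le_succ ⟨u, hu.1.1⟩) hadj.ne',
    (f ⟨u, hu.1.1⟩).2, hadj, fun y hy hne => hmax y (hf.le_of_adj_succ ⟨u, hu.1.1⟩ y hy) hne⟩

variable [DecidableEq V]

/-- The position in the schedule is strictly monotone along the relations which generate the
natural pre-order; this makes it a partial order. -/
theorem idxOf_lt (h : Schedule G I O F S) {x y : V} (hx : x ∈ S)
    (hy : y = F x ∨ G.Adj y (F x)) (hne : y ≠ x) : S.idxOf x < S.idxOf y := by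
  induction h with
  | nil => simp at hx
  | @cons u S hS huO huS hF hI hadj hnbr ih =>
    by_cases hxu : x = u
    · subst hxu
      rw [List.idxOf_cons_self, List.idxOf_cons_ne _ hne.symm]
      omega
    · have hxS : x ∈ S := by simpa [hxu] using hx
      have hyu : y ≠ u := by
        rintro rfl
        have := hS.processed_of_step hxS hy
        tauto
      rw [List.idxOf_cons_ne _ (Ne.symm hxu), List.idxOf_cons_ne _ hyu.symm]
      have := ih hxS
      omega

theorem injOn (h : Schedule G I O F S) : Set.InjOn F {x | x ∈ S} := by
  intro x hx y hy hxy
  by_contra hne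
  have h₁ := h.idxOf_lt (y := y) hx (.inr (hxy ▸ h.adj_succ hy)) (Ne.symm hne)
  have h₂ := h.idxOf_lt (y := x) hy (.inr (hxy ▸ h.adj_succ hx)) hne
  omega

/-- The function that is read off from a complete schedule. -/
def toFun (h : Schedule G I O F S) (hS : ∀ x, x ∉ O → x ∈ S) :
    {x : V // x ∉ O} → {x : V // x ∉ I} :=
  fun x => ⟨F x, h.succ_notMem_inp (hS x x.2)⟩

/-- A complete schedule yields a flow. -/
theorem isFlow (h : Schedule G I O F S) (hS : ∀ x, x ∉ O → x ∈ S) :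
    IsFlow G I O (h.toFun hS) (naturalLE G I O (h.toFun hS)) := by
  have key : ∀ x y, naturalLE G I O (h.toFun hS) x y → x = y ∨ S.idxOf x < S.idxOf y := by
    intro x y hxy
    induction hxy with
    | refl => exact .inl rfl
    | @tail y z _ hyz ih =>
      obtain ⟨hyO, hyz⟩ := hyz
      by_cases hzy : z = y
      · rwa [hzy]
      · have := h.idxOf_lt (hS y hyO) hyz hzy
        right
        rcases ih with rfl | ih <;> omega
  refine ⟨fun _ => .refl, fun _ _ _ h₁ h₂ => .trans h₁ h₂, ?_, fun x => h.adj_succ (hS x x.2),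
    fun x => .single ⟨x.2, .inl rfl⟩, fun x y hy => .single ⟨x.2, .inr hy⟩⟩
  intro x y hxy hyx
  rcases key x y hxy with rfl | h₁
  · rfl
  · rcases key y x hyx with rfl | h₂
    · rfl
    · omega

end Schedule

end Schedule

/-! ### The input in memory -/

namespace RAM

variable {n : ℕ} {G : SimpleGraph (Fin n)} {I O : Finset (Fin n)}
  {adj : Fin n → List (Fin n)} {inp out : List (Fin n)} {W : ℕ}

/-- The position at which the adjacency list of vertex `i` starts. -/
def startPos (adj : Fin n → List (Fin n)) (i : ℕ) : ℕ :=
  ∑ v : Fin n, if v.val < i then (adj v).length else 0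

theorem startPos_succ (adj : Fin n → List (Fin n)) (x : Fin n) :
    startPos adj (x + 1) = startPos adj x + (adj x).length := by
  have : ∀ v : Fin n, (if v.val < x.val + 1 then (adj v).length else 0) =
      (if v.val < x.val then (adj v).length else 0) + if v = x then (adj v).length else 0 := by
    intro v
    rcases lt_trichotomy v x with h | h | h
    · have h' : v.val < x.val := h
      simp [h.ne, h', h'.trans (Nat.lt_succ_self _)]
    · subst h; simp
    · have h' : x.val < v.val := h
      simp [h.ne', show ¬ v.val < x.val by omega, show ¬ v.val < x.val + 1 by omega]
  unfold startPos
  rw [Finset.sum_congr rfl fun v _ => this v, Finset.sum_add_distrib]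
  simp

theorem startPos_self (adj : Fin n → List (Fin n)) :
    startPos adj n = ∑ v : Fin n, (adj v).length := by
  simp [startPos]

theorem getElem?_flatMap_of_lt {α β : Type*} (g : α → List β) (l : List α) (j : ℕ)
    (hj : j < l.length) (i : ℕ) (hi : i < (g l[j]).length) :
    (l.flatMap g)[((l.take j).map fun a => (g a).length).sum + i]? = (g l[j])[i]? := by
  induction l generalizing j with
  | nil => simp at hj
  | cons a l ih =>
    cases j with
    | zero => simpa using List.getElem?_append_left (by simpa using hi)
    | succ j =>
      have hj' : j < l.length := by simpa using hj
      have hi' : i < (g l[j]).length := by simpa using hi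
      have := ih j hj' hi'
      simp only [List.take_succ_cons, List.map_cons, List.sum_cons, List.flatMap_cons,
        List.getElem_cons_succ]
      rw [List.getElem?_append_right (by omega), ← this]
      congr 1
      omega

/-- This form of the starting position matches the concatenation of the lists. -/
theorem startPos_eq_sum_take (adj : Fin n → List (Fin n)) (i : ℕ) (hi : i ≤ n) :
    startPos adj i = (((List.finRange n).take i).map fun a => (adj a).length).sum := by
  induction i with
  | zero => simp [startPos]
  | succ i ih =>
    have := startPos_succ adj ⟨i, hi⟩
    simp only at this
    rw [this, ih (by omega), List.take_succ_eq_append_getElem (by simpa using hi)]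
    simp

/-- The memory holds the input; no phase of the algorithm overwrites these cells. -/
structure Input (adj : Fin n → List (Fin n)) (inp out : List (Fin n)) (s : State) : Prop where
  reg0 : s.reg 0 = n
  reg1 : s.reg 1 = inp.length
  start : ∀ i ≤ n, s.mem 0 i = startPos adj i
  nbr : ∀ (x : Fin n) (i : ℕ) (h : i < (adj x).length),
    s.mem 1 (startPos adj x + i) = ((adj x)[i] : Fin n)
  inp : ∀ (i : ℕ) (h : i < inp.length), s.mem 2 i = (inp[i] : Fin n)
  out : ∀ (i : ℕ) (h : i < out.length), s.mem 3 i = (out[i] : Fin n)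

theorem input_initialState (adj : Fin n → List (Fin n)) (inp out : List (Fin n)) :
    Input adj inp out (initialState adj inp out) where
  reg0 := rfl
  reg1 := rfl
  start i hi := by simp [initialState, hi, startPos]
  nbr x i h := by
    have := getElem?_flatMap_of_lt adj (List.finRange n) x (by simp) i (by simpa using h)
    rw [← startPos_eq_sum_take adj x x.2.le] at this
    simp [initialState, List.getD_eq_getElem?_getD, List.getElem?_map, this, h]
  inp i h := by simp [initialState, h]
  out i h := by simp [initialState, h]

/-- The program leaves the input in memory. -/
def Prog.KeepsInput (p : Prog) : Prop :=
  (0 ∉ p.regs ∧ 1 ∉ p.regs) ∧ 0 ∉ p.arrays ∧ 1 ∉ p.arrays ∧ 2 ∉ p.arrays ∧ 3 ∉ p.arrays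

instance (p : Prog) : Decidable p.KeepsInput := by unfold Prog.KeepsInput; infer_instance

theorem Input.of_frame {p : Prog} {s s' : State} (h : Input adj inp out s) (hF : Frame p s s')
    (hp : p.KeepsInput) : Input adj inp out s' := by
  obtain ⟨⟨h0, h1⟩, a0, a1, a2, a3⟩ := hp
  constructor
  · rw [hF.reg 0 h0, h.reg0]
  · rw [hF.reg 1 h1, h.reg1]
  · rw [hF.mem 0 a0]; exact h.start
  · rw [hF.mem 1 a1]; exact h.nbr
  · rw [hF.mem 2 a2]; exact h.inp
  · rw [hF.mem 3 a3]; exact h.out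

theorem _root_.IsPresentation.card_inp (h : IsPresentation G I O adj inp out) :
    I.card = inp.length := by
  rw [← List.toFinset_card_of_nodup h.nodup_inp]
  congr 1
  ext y
  simp [h.mem_inp]

theorem _root_.IsPresentation.card_out (h : IsPresentation G I O adj inp out) :
    O.card = out.length := by
  rw [← List.toFinset_card_of_nodup h.nodup_out]
  congr 1
  ext y
  simp [h.mem_out]

/-- The standing assumptions: the input describes a geometry, and words are long enough. -/
structure Setting (W : ℕ) (G : SimpleGraph (Fin n)) (I O : Finset (Fin n))
    (adj : Fin n → List (Fin n)) (inp out : List (Fin n)) : Prop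
    extends IsPresentation G I O adj inp out where
  length_out : out.length = inp.length
  word : 4 * (n * n) + 4 * n + 10 ≤ W

namespace Setting

theorem length_adj_le (h : Setting W G I O adj inp out) (x : Fin n) : (adj x).length ≤ n := by
  simpa using (h.nodup_adj x).length_le_card

theorem length_inp_le (h : Setting W G I O adj inp out) : inp.length ≤ n := by
  simpa using h.nodup_inp.length_le_card

theorem startPos_le (h : Setting W G I O adj inp out) (i : ℕ) : startPos adj i ≤ n * n := by
  unfold startPos
  calc _ ≤ ∑ _v : Fin n, n := Finset.sum_le_sum fun v _ => by
        split
        · exact h.length_adj_le v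
        · omega
    _ = n * n := by simp

theorem mem_adj_comm (h : Setting W G I O adj inp out) {x y : Fin n} : x ∈ adj y ↔ y ∈ adj x := by
  rw [h.mem_adj, h.mem_adj, SimpleGraph.adj_comm]

theorem sum_length (h : Setting W G I O adj inp out) :
    ∑ x, (adj x).length = 2 * G.edgeSet.ncard := by
  classical
  have : ∀ x, (adj x).length = G.degree x := by
    intro x
    rw [← List.toFinset_card_of_nodup (h.nodup_adj x), ← SimpleGraph.card_neighborFinset_eq_degree]
    congr 1
    ext y
    simp [h.mem_adj]
  rw [Finset.sum_congr rfl fun x _ => this x, SimpleGraph.sum_degrees_eq_twice_card_edges,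
    ← SimpleGraph.coe_edgeFinset, Set.ncard_coe_finset]

theorem card_out_eq (h : Setting W G I O adj inp out) : O.card = inp.length :=
  h.card_out.trans h.length_out

end Setting

section Val

variable (s : State)

theorem Expr.val_lit (c : ℕ) : (Expr.lit c).val s = c := rfl
theorem Expr.val_reg (r : ℕ) : (Expr.reg r).val s = s.reg r := rfl
theorem Expr.val_load (a : ℕ) (i : Expr) : (Expr.load a i).val s = s.mem a (i.val s) := rfl
theorem Expr.val_add (e₁ e₂ : Expr) : (Expr.add e₁ e₂).val s = e₁.val s + e₂.val s := rfl
theorem Expr.val_sub (e₁ e₂ : Expr) : (Expr.sub e₁ e₂).val s = e₁.val s - e₂.val s := rfl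
theorem Expr.val_mul (e₁ e₂ : Expr) : (Expr.mul e₁ e₂).val s = e₁.val s * e₂.val s := rfl

end Val

/-! ### Loops over a neighbourhood -/

/-- Run `p` for all neighbours `y` of the vertex in register `rx`; the neighbour is in register `y`,
and the registers `j` and `b` are used for counting. -/
def nbrLoop (rx j b y : ℕ) (p : Prog) : Prog :=
  .seq (.assign j (.load 0 (.reg rx))) <|
  .seq (.assign b (.load 0 (.add (.reg rx) (.lit 1)))) <|
  forLoop j b (.seq (.assign y (.load 1 (.reg j))) p)

/-- The rule for loops over a neighbourhood.  The invariant speaks of arrays only, so that it cannot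
be affected by the bookkeeping in registers; each round costs `11` in addition to the body. -/
theorem WP.nbrLoop (hS : Setting W G I O adj inp out) {s : State} {Q : ℕ → State → Prop}
    {rx j b y : ℕ} {p : Prog} (hin : Input adj inp out s)
    (hkeep : (RAM.nbrLoop rx j b y p).KeepsInput)
    (x : Fin n) (hx : s.reg rx = x) (hj : j ∉ y :: p.regs) (hb : b ∉ y :: p.regs) (hbj : b ≠ j)
    (hjx : rx ≠ j) (Inv : ℕ → ℕ → (ℕ → ℕ → ℕ) → Prop) (h0 : Inv 0 0 s.mem)
    (hstep : ∀ i t s' (h : i < (adj x).length), Frame (RAM.nbrLoop rx j b y p) s s' →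
      s'.reg y = ((adj x)[i] : Fin n) → Inv i t s'.mem →
      WP W p s' fun t' s'' => Inv (i + 1) (t + t' + 11) s''.mem)
    (hQ : ∀ t s', Frame (RAM.nbrLoop rx j b y p) s s' → Inv (adj x).length t s'.mem →
      Q (t + 12) s') :
    WP W (RAM.nbrLoop rx j b y p) s Q := by
  have hword := hS.word
  have hs := hin.start x x.2.le
  have hs' := hin.start (x + 1) x.2
  have hle' := hS.startPos_le (x + 1)
  have hsucc := startPos_succ adj x
  unfold RAM.nbrLoop
  simp only [WP.seq_iff, WP.assign_iff, Expr.Fits, Expr.val_reg, Expr.val_load, Expr.val_add,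
    Expr.val_lit, Expr.cost, State.setReg_reg, State.setReg_mem, if_neg hjx, hx, hs, hs']
  refine ⟨by omega, by omega, ?_⟩
  set s₀ := (s.setReg j (startPos adj x)).setReg b (startPos adj (x + 1)) with hs₀
  have hF₀ : ∀ s', Frame (.seq (.seq (.assign y (.load 1 (.reg j))) p)
      (.assign j (.add (.reg j) (.lit 1)))) s₀ s' → Frame (RAM.nbrLoop rx j b y p) s s' := by
    intro s' hF
    constructor
    · intro r hr
      simp only [RAM.nbrLoop, RAM.forLoop, Prog.regs, List.mem_append, List.mem_cons,
        List.not_mem_nil, or_false, not_or] at hr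
      rw [hF.reg r (by simp [Prog.regs]; tauto)]
      simp [hs₀, hr.1, hr.2.1]
    · intro a ha
      simp only [RAM.nbrLoop, RAM.forLoop, Prog.arrays, List.mem_append, List.not_mem_nil, or_false,
        false_or] at ha
      rw [hF.mem a (by simp [Prog.arrays]; tauto)]
      simp [hs₀]
  refine WP.forLoop (startPos adj x) (startPos adj (x + 1))
    (fun i t s' => Inv (i - startPos adj x) t s'.mem) (by omega) ?_ ?_ hbj ?_ ?_ (by omega) ?_ ?_ ?_
  · simpa [Prog.regs] using hj
  · simpa [Prog.regs] using hb
  · simp [hs₀, hbj.symm]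
  · simp [hs₀]
  · simpa [hs₀] using h0
  · intro i t s' hi₁ hi₂ hi hF hI
    obtain ⟨d, rfl⟩ : ∃ d, i = startPos adj x + d := ⟨i - startPos adj x, by omega⟩
    have hin' := hin.of_frame (hF₀ s' hF) hkeep
    have hnbr := hin'.nbr x d (by omega)
    simp only [WP.seq_iff, WP.assign_iff, Expr.Fits, Expr.val_reg, Expr.val_load, Expr.cost, hi,
      hnbr]
    refine ⟨by omega, ?_⟩
    rw [Nat.add_sub_cancel_left] at hI
    refine (hstep d t (s'.setReg y _) (by omega) ?_ (by simp) hI).conseq ?_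
    · refine (hF₀ s' hF).trans ⟨fun r hr => ?_, fun a _ => rfl⟩
      simp only [RAM.nbrLoop, RAM.forLoop, Prog.regs, List.mem_append, List.mem_cons,
        List.not_mem_nil, or_false, not_or] at hr
      simp [hr.2.2.1]
    · intro t' s'' _ hI'
      have h₁ : startPos adj x + d + 1 - startPos adj x = d + 1 := by omega
      have h₂ : t + (1 + 1 + 1 + t') + 8 = t + t' + 11 := by omega
      rw [h₁, h₂]
      exact hI'
  · intro t s' hF _ hI
    have h₁ : startPos adj (x + 1) - startPos adj x = (adj x).length := by omega
    have h₂ : 1 + 1 + 1 + (1 + 1 + 1 + 1 + 1 + (t + 4)) = t + 12 := by omega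
    rw [h₁] at hI
    rw [h₂]
    exact hQ t s' (hF₀ s' hF) hI

end RAM

/-! ### Processing a vertex -/

theorem List.Nodup.getElem_notMem_take {α : Type*} {l : List α} (h : l.Nodup) {i : ℕ}
    (hi : i < l.length) : l[i] ∉ l.take i := by
  rw [List.mem_take_iff_getElem]
  rintro ⟨j, hj, he⟩
  have := (h.getElem_inj_iff).1 he
  omega

theorem List.mem_take_succ {α : Type*} {l : List α} {i : ℕ} (hi : i < l.length) {x : α} :
    x ∈ l.take (i + 1) ↔ x ∈ l.take i ∨ x = l[i] := by
  rw [List.take_succ_eq_append_getElem hi, List.mem_append, List.mem_singleton]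

theorem List.Nodup.countP_mem_insert {α : Type*} [DecidableEq α] {l : List α} (h : l.Nodup)
    {D : Finset α} {x : α} (hx : x ∉ D) :
    l.countP (· ∈ insert x D) = l.countP (· ∈ D) + if x ∈ l then 1 else 0 := by
  induction l with
  | nil => simp
  | cons a l ih =>
    rw [List.nodup_cons] at h
    rw [List.countP_cons, List.countP_cons, ih h.2]
    by_cases hax : a = x
    · subst hax
      simp [h.1, hx]
    · simp only [Finset.mem_insert, hax, false_or, List.mem_cons, Ne.symm hax]
      omega

/-- Exactly one entry of a list without repetitions is outside of `D`. -/
theorem List.Nodup.countP_add_one_eq_length_iff {α : Type*} [DecidableEq α] {l : List α}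
    (h : l.Nodup) {D : Finset α} :
    l.countP (· ∈ D) + 1 = l.length ↔ ∃ u ∈ l, u ∉ D ∧ ∀ y ∈ l, y ≠ u → y ∈ D := by
  have h₁ : l.length = l.countP (· ∈ D) + l.countP (fun y => decide (y ∉ D)) := by
    rw [List.length_eq_countP_add_countP (fun y => decide (y ∈ D))]
    simp
  have h₂ : l.countP (fun y => decide (y ∉ D)) = (l.toFinset \ D).card := by
    rw [List.countP_eq_length_filter, ← List.toFinset_card_of_nodup (h.filter _)]
    congr 1
    ext y
    simp
  rw [h₁, h₂, Nat.add_left_cancel_iff, eq_comm, Finset.card_eq_one]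
  simp only [Finset.eq_singleton_iff_unique_mem, Finset.mem_sdiff, List.mem_toFinset]
  constructor
  · rintro ⟨u, ⟨h₁, h₂⟩, h₃⟩
    exact ⟨u, h₁, h₂, fun y hy hne => by_contra fun hD => hne (h₃ y ⟨hy, hD⟩)⟩
  · rintro ⟨u, h₁, h₂, h₃⟩
    exact ⟨u, ⟨h₁, h₂⟩, fun y hy => by_contra fun hne => hy.2 (h₃ y hy.1 hne)⟩

namespace RAM

variable {n : ℕ} {G : SimpleGraph (Fin n)} {I O : Finset (Fin n)}
  {adj : Fin n → List (Fin n)} {inp out : List (Fin n)} {W : ℕ}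

/-- Array `8` flags the vertices in `D`; array `9` counts for each vertex its neighbours in `D`. -/
structure Marked (adj : Fin n → List (Fin n)) (D : Finset (Fin n)) (mem : ℕ → ℕ → ℕ) : Prop where
  flag : ∀ x : Fin n, mem 8 x = if x ∈ D then 1 else 0
  count : ∀ w : Fin n, mem 9 w = (adj w).countP (· ∈ D)

/-- Add the vertex in register `4` to the processed vertices. -/
def mark : Prog :=
  .seq (.store 8 (.reg 4) (.lit 1)) <|
  nbrLoop 4 5 6 7 (.store 9 (.reg 7) (.add (.load 9 (.reg 7)) (.lit 1)))

theorem WP.mark (hS : Setting W G I O adj inp out) {s : State} (hin : Input adj inp out s)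
    (x : Fin n) (hx : s.reg 4 = x) {D : Finset (Fin n)} (hD : Marked adj D s.mem) (hxD : x ∉ D) :
    WP W mark s fun t s' => t ≤ 17 * (adj x).length + 15 ∧ Marked adj (insert x D) s'.mem := by
  have hword := hS.word
  have hnd := hS.nodup_adj x
  unfold RAM.mark
  simp only [WP.seq_iff, WP.store_iff, Expr.Fits, Expr.val_reg, Expr.val_lit, Expr.cost, hx]
  refine ⟨by omega, by omega, ?_⟩
  refine WP.nbrLoop hS (hin.of_frame (p := .store 8 (.reg 4) (.lit 1)) ?_ (by decide)) (by decide)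
    x hx (by decide) (by decide) (by decide) (by decide)
    (fun i t mem => t = 17 * i ∧ ∀ w : Fin n, mem 9 w =
      (adj w).countP (· ∈ D) + if w ∈ (adj x).take i then 1 else 0) ?_ ?_ ?_
  · exact ⟨fun _ _ => rfl, fun a ha => by simp_all [Prog.arrays]⟩
  · exact ⟨rfl, fun w => by simp [hD.count]⟩
  · rintro i t s' hi hF hy ⟨ht, hI⟩
    have hle : (adj (adj x)[i]).countP (· ∈ D) ≤ n :=
      List.countP_le_length.trans (hS.length_adj_le _)
    have hnot : (adj x)[i] ∉ (adj x).take i := hnd.getElem_notMem_take hi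
    have hc := hI (adj x)[i]
    rw [if_neg hnot] at hc
    simp only [WP.store_iff, Expr.Fits, Expr.val_reg, Expr.val_load, Expr.val_add, Expr.val_lit,
      Expr.cost, hy, hc, State.setMem_mem, if_pos]
    refine ⟨by omega, by omega, by omega, fun w => ?_⟩
    simp only [List.mem_take_succ hi]
    by_cases hw : w = (adj x)[i]
    · subst hw
      simp
    · have : (w : ℕ) ≠ ((adj x)[i] : Fin n) := fun h => hw (Fin.ext h)
      rw [Function.update_of_ne this, hI w]
      simp [hw]
  · rintro t s' hF ⟨ht, hI⟩
    refine ⟨by omega, ?_, ?_⟩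
    · intro w
      rw [hF.mem 8 (by decide)]
      simp only [State.setMem_mem, if_pos]
      by_cases hw : w = x
      · subst hw; simp
      · have : (w : ℕ) ≠ x := fun h => hw (Fin.ext h)
        rw [Function.update_of_ne this, hD.flag w]
        simp [hw]
    · intro w
      rw [hI w, List.take_length, (hS.nodup_adj w).countP_mem_insert hxD]
      congr 1
      simp [hS.mem_adj_comm]

/-! ### Initialization -/

/-- Flag the inputs in array `11`. -/
def flagInputs : Prog :=
  .seq (.assign 3 (.lit 0)) <|
  forLoop 3 1 (.store 11 (.load 2 (.reg 3)) (.lit 1))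

theorem WP.flagInputs (hS : Setting W G I O adj inp out) {s : State} (hin : Input adj inp out s)
    (h11 : s.mem 11 = fun _ => 0) : WP W flagInputs s fun t s' => t ≤ 12 * inp.length + 6 ∧
      ∀ x : Fin n, s'.mem 11 x = if x ∈ I then 1 else 0 := by
  have hword := hS.word
  have hk := hS.length_inp_le
  unfold RAM.flagInputs
  simp only [WP.seq_iff, WP.assign_iff, Expr.Fits, Expr.val_lit, Expr.cost]
  refine ⟨by omega, ?_⟩
  refine WP.forLoop 0 inp.length (fun i t s' => t = 12 * i ∧
    ∀ x : Fin n, s'.mem 11 x = if x ∈ inp.take i then 1 else 0) (by omega) (by decide) (by decide)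
    (by decide) (by simp) (by simp [hin.reg1]) (by omega) ?_ ?_ ?_
  · simp [h11]
  · rintro i t s' - hi hr hF ⟨ht, hI⟩
    have hin' := (hin.of_frame (p := .assign 3 (.lit 0)) (s' := s.setReg 3 0)
      ⟨fun r hr => by simp_all [Prog.regs], fun _ _ => rfl⟩ (by decide)).of_frame hF (by decide)
    have hx := hin'.inp i hi
    simp only [WP.store_iff, Expr.Fits, Expr.val_reg, Expr.val_load, Expr.val_lit,
      Expr.cost, hr, hx, State.setMem_mem, State.setReg_mem, if_pos]
    refine ⟨by omega, by omega, by omega, fun x => ?_⟩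
    simp only [List.mem_take_succ hi]
    by_cases hw : x = inp[i]
    · subst hw
      simp
    · have : (x : ℕ) ≠ (inp[i] : Fin n) := fun h => hw (Fin.ext h)
      rw [Function.update_of_ne this, hI x]
      simp [hw]
  · rintro t s' hF hr ⟨ht, hI⟩
    refine ⟨by omega, fun x => ?_⟩
    rw [hI x]
    simp [hS.mem_inp]

/-- Process the outputs: they start the list of processed vertices in array `12` and form the first
frontier in array `10`. -/
def markOutputs : Prog :=
  .seq (.assign 3 (.lit 0)) <|
  forLoop 3 1 <|
    .seq (.assign 4 (.load 3 (.reg 3))) <|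
    .seq (.store 10 (.reg 3) (.reg 4)) <|
    .seq (.store 12 (.reg 3) (.reg 4)) mark

theorem WP.markOutputs (hS : Setting W G I O adj inp out) {s : State} (hin : Input adj inp out s)
    (h8 : s.mem 8 = fun _ => 0) (h9 : s.mem 9 = fun _ => 0) :
    WP W markOutputs s fun t s' => t ≤ 40 * inp.length + 34 * G.edgeSet.ncard + 6 ∧
      Marked adj O s'.mem ∧ ∀ (i : ℕ) (hi : i < out.length),
        s'.mem 10 i = (out[i] : Fin n) ∧ s'.mem 12 i = (out[i] : Fin n) := by
  have hword := hS.word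
  have hk := hS.length_inp_le
  have hlo := hS.length_out
  unfold RAM.markOutputs
  simp only [WP.seq_iff, WP.assign_iff, Expr.Fits, Expr.val_lit, Expr.cost]
  refine ⟨by omega, ?_⟩
  refine WP.forLoop 0 inp.length (fun i t s' =>
      t ≤ 40 * i + 17 * ∑ x ∈ (out.take i).toFinset, (adj x).length ∧
      Marked adj (out.take i).toFinset s'.mem ∧ ∀ (j : ℕ) (hj : j < out.length), j < i →
        s'.mem 10 j = (out[j] : Fin n) ∧ s'.mem 12 j = (out[j] : Fin n))
    (by omega) (by decide) (by decide)
    (by decide) (by simp) (by simp [hin.reg1]) (by omega) ?_ ?_ ?_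
  · exact ⟨by simp, ⟨by simp [h8], by simp [h9]⟩, by omega⟩
  · rintro i t s' - hi hr hF ⟨ht, hM, hI⟩
    have hin' := (hin.of_frame (p := .assign 3 (.lit 0)) (s' := s.setReg 3 0)
      ⟨fun r hr => by simp_all [Prog.regs], fun _ _ => rfl⟩ (by decide)).of_frame hF (by decide)
    have hio : i < out.length := by omega
    have hx := hin'.out i hio
    have hnot : out[i] ∉ (out.take i).toFinset := by
      rw [List.mem_toFinset]; exact hS.nodup_out.getElem_notMem_take hio
    have hins : (out.take (i + 1)).toFinset = insert out[i] (out.take i).toFinset := by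
      ext y
      simp only [List.mem_toFinset, List.mem_take_succ hio, Finset.mem_insert]
      tauto
    simp only [WP.seq_iff, WP.assign_iff, WP.store_iff, Expr.Fits, Expr.val_reg, Expr.val_load,
      Expr.cost, hr, hx, State.setReg_reg, State.setMem_reg, if_pos]
    refine ⟨by omega, by simp; omega, by omega, by simp; omega, by omega, ?_⟩
    refine (WP.mark (D := (out.take i).toFinset) hS (hin'.of_frame
      (p := .seq (.assign 4 (.load 3 (.reg 3))) <| .seq (.store 10 (.reg 3) (.reg 4)) <|
        (.store 12 (.reg 3) (.reg 4))) ⟨fun r hr => ?_, fun a ha => ?_⟩ (by decide))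
        out[i] ?_ ⟨?_, ?_⟩ hnot).conseq ?_
    · simp_all [Prog.regs]
    · simp_all [Prog.arrays]
    · simp
    · simpa using hM.flag
    · simpa using hM.count
    · rintro t' s'' hF' ⟨ht', hM'⟩
      rw [hins, Finset.sum_insert hnot]
      refine ⟨by omega, hM', fun j hj hji => ?_⟩
      rw [State.setReg_mem, hF'.mem 10 (by decide), hF'.mem 12 (by decide)]
      by_cases hj' : j = i
      · subst hj'; simp
      · simp [Function.update_of_ne hj', hI j hj (by omega)]
  · rintro t s' hF hr ⟨ht, hM, hI⟩
    have hO : (out.take inp.length).toFinset = O := by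
      ext y
      rw [← hlo, List.take_length, List.mem_toFinset, hS.mem_out]
    rw [hO] at hM ht
    have hsum := hS.sum_length
    have : ∑ x ∈ O, (adj x).length ≤ ∑ x, (adj x).length :=
      Finset.sum_le_sum_of_subset (Finset.subset_univ O)
    exact ⟨by omega, hM, fun j hj => hI j hj (by omega)⟩

/-! ### Building the schedule -/

variable {F : Fin n → Fin n} {S : List (Fin n)}

/-- The memory describes the schedule `S` with the function `F`.  The frontier in array `10` contains
every processed vertex that is not yet a value of `F`; array `12` lists the processed vertices in
the order in which they have been processed. -/
structure Stage (G : SimpleGraph (Fin n)) (I O : Finset (Fin n)) (adj : Fin n → List (Fin n))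
    (inp out : List (Fin n)) (F : Fin n → Fin n) (S : List (Fin n)) (mem : ℕ → ℕ → ℕ) : Prop where
  sched : Schedule G I O F S
  succ : ∀ x ∈ S, mem 4 x = F x
  marked : Marked adj (S.toFinset ∪ O) mem
  front : ∀ p < inp.length, ∃ v : Fin n, mem 10 p = v ∧ (v ∈ S ∨ v ∈ O)
  front_or_used : ∀ v : Fin n, v ∈ S ∨ v ∈ O →
    (∃ p < inp.length, mem 10 p = v) ∨ ∃ x ∈ S, F x = v
  isInp : ∀ x : Fin n, mem 11 x = if x ∈ I then 1 else 0
  ord_out : ∀ (i : ℕ) (h : i < out.length), mem 12 i = (out[i] : Fin n)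
  ord : ∀ (i : ℕ) (h : i < S.reverse.length), mem 12 (inp.length + i) = (S.reverse[i] : Fin n)

theorem Stage.card_processed (hS : Setting W G I O adj inp out) (h : Schedule G I O F S) :
    (S.toFinset ∪ O).card = inp.length + S.length := by
  rw [Finset.card_union_of_disjoint, hS.card_out_eq, List.toFinset_card_of_nodup h.nodup, add_comm]
  rw [Finset.disjoint_left]
  intro x hx
  exact h.notMem_out (List.mem_toFinset.1 hx)

/-- The frontier vertex number `p` is not an input and all its neighbours but one have been
processed. -/
def Ready (I : Finset (Fin n)) (adj : Fin n → List (Fin n)) (mem : ℕ → ℕ → ℕ) (p : ℕ) : Prop :=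
  ∃ v : Fin n, mem 10 p = v ∧ v ∉ I ∧ mem 9 v + 1 = (adj v).length

/-- Unless all vertices have been processed, some frontier vertex is ready if there is a flow. -/
theorem Stage.exists_ready (hS : Setting W G I O adj inp out) {mem : ℕ → ℕ → ℕ}
    (h : Stage G I O adj inp out F S mem) (hflow : HasFlow G I O) (hn : inp.length + S.length < n) :
    ∃ p < inp.length, Ready I adj mem p := by
  have hex : ∃ x, x ∉ O ∧ x ∉ S := by
    by_contra hall
    push Not at hall
    have : S.toFinset ∪ O = Finset.univ := by
      ext x
      have := hall x
      simp only [Finset.mem_union, List.mem_toFinset, Finset.mem_univ, iff_true]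
      tauto
    have hc := Stage.card_processed hS h.sched
    rw [this] at hc
    simp at hc
    omega
  obtain ⟨u, v, huO, huS, hv, hvI, hadj, hnbr⟩ := Schedule.exists_next hflow S hex
  rcases h.front_or_used v hv with ⟨p, hp, hpv⟩ | ⟨x, hx, rfl⟩
  · refine ⟨p, hp, v, hpv, hvI, ?_⟩
    rw [h.marked.count, (hS.nodup_adj v).countP_add_one_eq_length_iff]
    refine ⟨u, (hS.mem_adj v u).2 hadj.symm, by simp [huO, huS], fun y hy hne => ?_⟩
    have := hnbr y ((hS.mem_adj v y).1 hy).symm hne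
    simpa using this
  · have := h.sched.processed_of_step hx (.inr hadj)
    tauto

/-- Set register `10` to `p + 1` for some ready frontier vertex `p`, or to `0` if there is none. -/
def scan : Prog :=
  .seq (.assign 10 (.lit 0)) <|
  .seq (.assign 3 (.lit 0)) <|
  forLoop 3 1 <|
    .seq (.assign 4 (.load 10 (.reg 3))) <|
    .seq (.assign 7 (.sub (.load 0 (.add (.reg 4) (.lit 1))) (.load 0 (.reg 4)))) <|
    .ite (.load 11 (.reg 4)) .skip <|
    .ite (.lt (.load 9 (.reg 4)) (.reg 7))
      (.ite (.lt (.reg 7) (.add (.load 9 (.reg 4)) (.lit 2)))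
        (.assign 10 (.add (.reg 3) (.lit 1))) .skip) .skip

theorem WP.scan (hS : Setting W G I O adj inp out) {s : State} (hin : Input adj inp out s)
    (hst : Stage G I O adj inp out F S s.mem) :
    WP W scan s fun t s' => t ≤ 38 * inp.length + 8 ∧ s'.mem = s.mem ∧
      ((s'.reg 10 = 0 ∧ ∀ p < inp.length, ¬ Ready I adj s.mem p) ∨
        ∃ p < inp.length, s'.reg 10 = p + 1 ∧ Ready I adj s.mem p) := by
  have hword := hS.word
  have hk := hS.length_inp_le
  unfold RAM.scan
  simp only [WP.seq_iff, WP.assign_iff, Expr.Fits, Expr.val_lit, Expr.cost]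
  refine ⟨by omega, by omega, ?_⟩
  refine WP.forLoop 0 inp.length (fun i t s' => t ≤ 38 * i ∧ s'.mem = s.mem ∧
      ((s'.reg 10 = 0 ∧ ∀ p < i, ¬ Ready I adj s.mem p) ∨
        ∃ p < inp.length, s'.reg 10 = p + 1 ∧ Ready I adj s.mem p)) (by omega) (by decide)
    (by decide) (by decide) (by simp) (by simp [hin.reg1]) (by omega) ?_ ?_ ?_
  · simp
  · rintro i t s' - hi hr hF ⟨ht, hm, hI⟩
    have hin' := (hin.of_frame (p := .seq (.assign 10 (.lit 0)) (.assign 3 (.lit 0)))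
      (s' := (s.setReg 10 0).setReg 3 0)
      ⟨fun r hr => by simp_all [Prog.regs], fun _ _ => rfl⟩ (by decide)).of_frame hF (by decide)
    obtain ⟨v, hv, -⟩ := hst.front i hi
    have hs₁ := hin'.start v v.2.le
    have hs₂ := hin'.start (v + 1) v.2
    rw [hm] at hs₁ hs₂
    have hle' := hS.startPos_le (v + 1)
    have hsucc := startPos_succ adj v
    have hsub : startPos adj (v + 1) - startPos adj v = (adj v).length := by omega
    have hcnt : s.mem 9 v ≤ (adj v).length := by
      rw [hst.marked.count]; exact List.countP_le_length
    have hinp := hst.isInp v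
    have hinp' : s.mem 11 v ≤ 1 := by rw [hinp]; split <;> omega
    simp only [WP.seq_iff, WP.assign_iff, WP.ite_iff, WP.skip_iff, Expr.Fits, Expr.val_reg,
      Expr.val_load, Expr.val_add, Expr.val_sub, Expr.val_lit, Expr.cost, hr, hm, hv,
      State.setReg_reg, State.setReg_mem, if_pos, hs₁, hs₂, hsub, Expr.val_lt_ne_zero_iff,
      Expr.val_lt_eq_zero_iff, Nat.reduceEqDiff, if_false]
    have hnot : ¬ Ready I adj s.mem i → ((s'.reg 10 = 0 ∧ ∀ p < i + 1, ¬ Ready I adj s.mem p) ∨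
        ∃ p < inp.length, s'.reg 10 = p + 1 ∧ Ready I adj s.mem p) := by
      intro hnr
      rcases hI with ⟨h₁, h₂⟩ | h
      · refine .inl ⟨h₁, fun p hp => ?_⟩
        by_cases hpi : p = i
        · rwa [hpi]
        · exact h₂ p (by omega)
      · exact .inr h
    have hready : Ready I adj s.mem i ↔ v ∉ I ∧ s.mem 9 v + 1 = (adj v).length := by
      constructor
      · rintro ⟨w, hw, h⟩
        rw [hv] at hw
        rwa [Fin.ext hw]
      · exact fun h => ⟨v, hv, h⟩
    have hI' : s.mem 11 v = 0 ↔ v ∉ I := by rw [hinp]; split <;> simp_all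
    refine ⟨by omega, ⟨⟨by omega, by omega⟩, by omega⟩, by omega, fun hi₁ => ?_, fun hi₁ => ?_⟩
    · refine ⟨by omega, trivial, hnot ?_⟩
      rw [hready, ← hI']
      tauto
    · refine ⟨⟨⟨by omega, by omega⟩, by omega, by omega⟩, fun hlt => ?_, fun hlt => ?_⟩
      · refine ⟨⟨by omega, ⟨⟨by omega, by omega⟩, by omega, by omega⟩, by omega⟩,
          fun hlt' => ?_, fun hlt' => ?_⟩
        · refine ⟨by omega, by omega, trivial, .inr ⟨i, hi, rfl, ?_⟩⟩
          rw [hready, ← hI']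
          omega
        · refine ⟨by omega, trivial, hnot ?_⟩
          rw [hready]
          omega
      · refine ⟨by omega, trivial, hnot ?_⟩
        rw [hready]
        omega
  · rintro t s' hF hr ⟨ht, hI⟩
    exact ⟨by omega, hI⟩

/-- Process the only unprocessed neighbour of the frontier vertex whose number is one less than
register `10`. -/
def advance : Prog :=
  .seq (.assign 12 (.load 10 (.sub (.reg 10) (.lit 1)))) <|
  .seq (.assign 5 (.load 0 (.reg 12))) <|
  .seq (.loop (.load 8 (.load 1 (.reg 5))) (.assign 5 (.add (.reg 5) (.lit 1)))) <|
  .seq (.assign 4 (.load 1 (.reg 5))) <|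
  .seq (.store 4 (.reg 4) (.reg 12)) <|
  .seq (.store 10 (.sub (.reg 10) (.lit 1)) (.reg 4)) <|
  .seq (.store 12 (.reg 8) (.reg 4)) <|
  .seq (.assign 8 (.add (.reg 8) (.lit 1))) mark

/-- The effect of processing `u` with `F u = v`: in the frontier, `u` takes the place of `v`. -/
theorem Stage.next (hS : Setting W G I O adj inp out) {mem mem' : ℕ → ℕ → ℕ}
    (h : Stage G I O adj inp out F S mem) {p : ℕ} (hp : p < inp.length) {u v : Fin n}
    (hpv : mem 10 p = v) (hvI : v ∉ I) (huO : u ∉ O) (huS : u ∉ S) (hadj : G.Adj u v)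
    (hnbr : ∀ y, G.Adj y v → y ≠ u → y ∈ S ∨ y ∈ O)
    (h4 : mem' 4 = Function.update (mem 4) u v) (h10 : mem' 10 = Function.update (mem 10) p u)
    (h11 : mem' 11 = mem 11) (h12 : mem' 12 = Function.update (mem 12) (inp.length + S.length) u)
    (hM : Marked adj (insert u (S.toFinset ∪ O)) mem') :
    Stage G I O adj inp out (Function.update F u v) (u :: S) mem' where
  sched := by
    have hFS : ∀ x ∈ S, Function.update F u v x = F x := by
      intro x hx
      rw [Function.update_of_ne]
      rintro rfl
      exact huS hx
    obtain ⟨v', hv', hpr⟩ := h.front p hp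
    obtain rfl : v = v' := Fin.ext (hpv.symm.trans hv')
    refine .cons (h.sched.congr hFS) huO huS ?_ ?_ ?_ ?_ <;> rw [Function.update_self] <;> assumption
  succ x hx := by
    rw [h4]
    by_cases hxu : x = u
    · subst hxu; simp
    · have : (x : ℕ) ≠ u := fun h => hxu (Fin.ext h)
      rw [Function.update_of_ne this, Function.update_of_ne hxu]
      exact h.succ x (by simpa [hxu] using hx)
  marked := by
    rwa [List.toFinset_cons, Finset.insert_union]
  front q hq := by
    rw [h10]
    by_cases hqp : q = p
    · subst hqp
      exact ⟨u, by simp, by simp⟩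
    · rw [Function.update_of_ne hqp]
      obtain ⟨w, hw, hpr⟩ := h.front q hq
      exact ⟨w, hw, by rw [List.mem_cons]; tauto⟩
  front_or_used w hw := by
    rw [h10]
    by_cases hwu : w = u
    · subst hwu
      exact .inl ⟨p, hp, by simp⟩
    · have hw' : w ∈ S ∨ w ∈ O := by simpa [hwu] using hw
      rcases h.front_or_used w hw' with ⟨q, hq, hqw⟩ | ⟨x, hx, rfl⟩
      · by_cases hqp : q = p
        · subst hqp
          exact .inr ⟨u, List.mem_cons_self, by
            rw [Function.update_self]; exact Fin.ext (hpv.symm.trans hqw)⟩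
        · exact .inl ⟨q, hq, by rw [Function.update_of_ne hqp, hqw]⟩
      · refine .inr ⟨x, List.mem_cons_of_mem _ hx, ?_⟩
        rw [Function.update_of_ne]
        rintro rfl
        exact huS hx
  isInp := by rw [h11]; exact h.isInp
  ord_out i hi := by
    have := hS.length_out
    rw [h12, Function.update_of_ne (by omega)]
    exact h.ord_out i hi
  ord i hi := by
    rw [h12]
    by_cases his : i = S.length
    · subst his
      simp
    · have hi' : i < S.reverse.length := by
        simp only [List.length_reverse, List.length_cons] at hi ⊢
        omega
      rw [Function.update_of_ne (by omega), h.ord i hi']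
      simp only [List.reverse_cons]
      rw [List.getElem_append_left hi']

/-- A ready frontier vertex allows one more vertex to be processed.  The scan of its neighbours and
the update of the counters are paid for by the two degrees. -/
theorem WP.advance (hS : Setting W G I O adj inp out) {s : State} (hin : Input adj inp out s)
    (hst : Stage G I O adj inp out F S s.mem) (h8 : s.reg 8 = inp.length + S.length)
    {p : ℕ} (hp : p < inp.length) (h10 : s.reg 10 = p + 1) (hready : Ready I adj s.mem p) :
    WP W advance s fun t s' => ∃ (F' : Fin n → Fin n) (u : Fin n),
      (∀ x ∈ S, F' x = F x) ∧
      t ≤ 17 * ((adj u).length + (adj (F' u)).length) + 50 ∧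
      Stage G I O adj inp out F' (u :: S) s'.mem ∧ s'.reg 8 = inp.length + S.length + 1 := by
  have hword := hS.word
  obtain ⟨v, hpv, hvI, hcnt⟩ := hready
  rw [hst.marked.count, (hS.nodup_adj v).countP_add_one_eq_length_iff] at hcnt
  obtain ⟨u, hu, huD, hnbr⟩ := hcnt
  obtain ⟨j, hj, hju⟩ := List.getElem_of_mem hu
  have huO : u ∉ O := fun h => huD (Finset.mem_union_right _ h)
  have huS : u ∉ S := fun h => huD (Finset.mem_union_left _ (List.mem_toFinset.2 h))
  have hbefore : ∀ i (hi : i < (adj v).length), i < j → (adj v)[i] ∈ S.toFinset ∪ O := by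
    intro i hi hij
    refine hnbr _ (List.getElem_mem hi) fun h => ?_
    rw [← hju] at h
    have := ((hS.nodup_adj v).getElem_inj_iff).1 h
    omega
  have hcard : inp.length + S.length < n := by
    rw [← Stage.card_processed hS hst.sched]
    have := Finset.card_lt_univ_of_notMem huD
    simpa using this
  have hle' := hS.startPos_le (v + 1)
  have hsucc := startPos_succ adj v
  have hs₁ := hin.start v v.2.le
  unfold RAM.advance
  simp only [WP.seq_iff, WP.assign_iff, Expr.Fits, Expr.val_reg, Expr.val_load, Expr.val_sub,
    Expr.val_lit, Expr.cost, State.setReg_reg, State.setReg_mem, h10, Nat.add_sub_cancel, hpv, if_pos,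
    hs₁]
  refine ⟨by omega, by omega, ?_⟩
  set s₀ := (s.setReg 12 v).setReg 5 (startPos adj v) with hs₀
  refine WP.loop j (fun i t s' => t = 8 * i ∧ s'.reg 5 = startPos adj v + i) (by simp [hs₀]) ?_ ?_ ?_
  · rintro i t s' hi hF ⟨ht, h5⟩
    have hm : s'.mem = s.mem := funext fun a => hF.mem a (by simp [Prog.arrays])
    have hil : i < (adj v).length := by omega
    have hnb := hin.nbr v i hil
    have hfl := hst.marked.flag (adj v)[i]
    rw [if_pos (hbefore i hil hi)] at hfl
    simp only [WP.assign_iff, Expr.Fits, Expr.val_reg, Expr.val_load, Expr.val_add, Expr.val_lit,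
      Expr.cost, State.setReg_reg, if_pos, h5, hm, hnb, hfl]
    omega
  · rintro t s' hF ⟨ht, h5⟩
    have hm : s'.mem = s.mem := funext fun a => hF.mem a (by simp [Prog.arrays])
    have hnb := hin.nbr v j hj
    have hfl := hst.marked.flag u
    rw [if_neg huD] at hfl
    simp only [Expr.Fits, Expr.val_reg, Expr.val_load, h5, hm, hnb, hju, hfl,
      and_true]
    omega
  · rintro t s' hF ⟨ht, h5⟩
    have hm : s'.mem = s.mem := funext fun a => hF.mem a (by simp [Prog.arrays])
    have hnb := hin.nbr v j hj
    have hr : ∀ r, r ≠ 5 → r ≠ 12 → s'.reg r = s.reg r := by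
      intro r h₁ h₂
      rw [hF.reg r (by simp [Prog.regs, h₁])]
      simp [hs₀, h₁, h₂]
    have h12' : s'.reg 12 = v := by
      rw [hF.reg 12 (by simp [Prog.regs])]
      simp [hs₀]
    have h10' : s'.reg 10 = p + 1 := by rw [hr 10 (by decide) (by decide), h10]
    have h8' : s'.reg 8 = inp.length + S.length := by rw [hr 8 (by decide) (by decide), h8]
    simp only [WP.store_iff, Expr.Fits, Expr.val_reg, Expr.val_add, Expr.val_sub, Expr.val_lit,
      Expr.cost, State.setReg_reg, State.setMem_reg, h5, hm, hnb, hju, if_pos, Nat.reduceEqDiff, if_false,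
      h12', h10', h8', Nat.add_sub_cancel]
    refine ⟨by omega, by omega, by omega, by omega, by omega, by omega, by omega, by omega, ?_⟩
    refine (WP.mark (D := S.toFinset ∪ O) hS (hin.of_frame (p := RAM.advance)
      ⟨fun r hr' => ?_, fun a ha => ?_⟩ (by decide)) u ?_ ⟨?_, ?_⟩ huD).conseq ?_
    · simp only [RAM.advance, Prog.regs, List.mem_append, List.mem_cons, List.not_mem_nil, or_false,
        not_or] at hr'
      simp [hr', hr]
    · simp only [RAM.advance, Prog.arrays, List.mem_append, List.mem_cons, List.not_mem_nil,
        or_false, not_or] at ha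
      simp [ha, hm]
    · simp
    · simpa [hm] using hst.marked.flag
    · simpa [hm] using hst.marked.count
    · rintro t' s'' hF' ⟨ht', hM⟩
      refine ⟨Function.update F u v, u, fun x hx => ?_, ?_, ?_, ?_⟩
      · rw [Function.update_of_ne]
        rintro rfl
        exact huS hx
      · rw [Function.update_self]
        omega
      · refine hst.next hS hp hpv hvI huO huS ((hS.mem_adj v u).1 hu).symm (fun y hy hne => ?_)
          ?_ ?_ ?_ ?_ hM
        · have := hnbr y ((hS.mem_adj v y).2 hy.symm) hne
          simpa using this
        · rw [hF'.mem 4 (by decide)]; simp [hm]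
        · rw [hF'.mem 10 (by decide)]; simp [hm]
        · rw [hF'.mem 11 (by decide)]; simp [hm]
        · rw [hF'.mem 12 (by decide)]; simp [hm]
      · rw [hF'.reg 8 (by decide)]; simp

/-- The stages: `n - k` times, process a vertex if this is possible. -/
def stages : Prog :=
  .seq (.assign 8 (.reg 1)) <|
  .seq (.assign 9 (.reg 1)) <|
  forLoop 9 0 <| .seq scan (.ite (.reg 10) advance .skip)

/-- The stages build a schedule, which is complete if there is a flow.  Since the vertices of the
schedule and their values under `F` are distinct, all degrees together add up to `O(m)`. -/
theorem WP.stages (hS : Setting W G I O adj inp out) {s : State} (hin : Input adj inp out s)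
    (hst : Stage G I O adj inp out F [] s.mem) :
    WP W stages s fun t s' => ∃ (F' : Fin n → Fin n) (S : List (Fin n)),
      t ≤ (n - inp.length) * (38 * inp.length + 68) + 68 * G.edgeSet.ncard + 8 ∧
      Stage G I O adj inp out F' S s'.mem ∧ s'.reg 8 = inp.length + S.length ∧
      inp.length + S.length ≤ n ∧ (inp.length + S.length = n ∨ ¬ HasFlow G I O) := by
  have hword := hS.word
  have hk := hS.length_inp_le
  unfold RAM.stages
  simp only [WP.seq_iff, WP.assign_iff, Expr.Fits, Expr.val_reg, Expr.cost,
    State.setReg_reg, OfNat.one_ne_ofNat, if_false, hin.reg1]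
  refine ⟨by omega, by omega, ?_⟩
  refine WP.forLoop inp.length n (fun i t s' => ∃ (F' : Fin n → Fin n) (S : List (Fin n)),
      t ≤ (i - inp.length) * (38 * inp.length + 68) +
        17 * (S.map fun x => (adj x).length + (adj (F' x)).length).sum ∧
      Stage G I O adj inp out F' S s'.mem ∧ s'.reg 8 = inp.length + S.length ∧
      (inp.length + S.length = i ∨ ¬ HasFlow G I O)) (by omega) (by decide)
    (by decide) (by decide) (by simp) (by simp [hin.reg0]) (by omega) ?_ ?_ ?_
  · exact ⟨F, [], by simp, hst, by simp, by simp⟩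
  · rintro i t s' hki hi hr hF ⟨F', S, ht, hst', h8, hfl⟩
    have hin' := (hin.of_frame (p := .seq (.assign 8 (.lit 0)) (.assign 9 (.lit 0)))
      (s' := (s.setReg 8 inp.length).setReg 9 inp.length)
      ⟨fun r hr => by simp_all [Prog.regs], fun _ _ => rfl⟩ (by decide)).of_frame hF (by decide)
    have hmul : (i + 1 - inp.length) * (38 * inp.length + 68) =
        (i - inp.length) * (38 * inp.length + 68) + (38 * inp.length + 68) := by
      rw [Nat.sub_add_comm hki]; ring
    rw [hmul, WP.seq_iff]
    refine (WP.scan hS hin' hst').conseq ?_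
    rintro t₁ s₁ hF₁ ⟨ht₁, hm, hres⟩
    have hin₁ := hin'.of_frame hF₁ (by decide)
    have h8₁ : s₁.reg 8 = inp.length + S.length := by rw [hF₁.reg 8 (by decide), h8]
    simp only [WP.ite_iff, WP.skip_iff, Expr.Fits, Expr.val_reg, Expr.cost]
    rcases hres with ⟨h10, hno⟩ | ⟨p, hp, h10, hready⟩
    · refine ⟨by omega, fun h => (h h10).elim, fun _ => ⟨F', S, by omega, ?_, ?_, ?_⟩⟩
      · rw [State.setReg_mem, hm]; exact hst'
      · simpa using h8₁
      · rcases hfl with hfl | hfl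
        · refine .inr fun hflow => ?_
          obtain ⟨p, hp, hready⟩ := hst'.exists_ready hS hflow (by omega)
          exact hno p hp hready
        · exact .inr hfl
    · refine ⟨by omega, fun _ => ?_, fun h => by omega⟩
      rw [← hm] at hst' hready
      refine (WP.advance hS hin₁ hst' h8₁ hp h10 hready).conseq ?_
      rintro t₂ s₂ hF₂ ⟨F₂, u, hFF, ht₂, hst₂, h8₂⟩
      refine ⟨F₂, u :: S, ?_, hst₂, by simpa [add_assoc] using h8₂, ?_⟩
      · have : (S.map fun x => (adj x).length + (adj (F₂ x)).length) =
            S.map fun x => (adj x).length + (adj (F' x)).length :=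
          List.map_congr_left fun x hx => by rw [hFF x hx]
        rw [List.map_cons, List.sum_cons, this]
        omega
      · rcases hfl with hfl | hfl
        · left; simp; omega
        · exact .inr hfl
  · rintro t s' hF hr ⟨F', S, ht, hst', h8, hfl⟩
    have hcard : inp.length + S.length ≤ n := by
      rw [← Stage.card_processed hS hst'.sched]
      simpa using Finset.card_le_univ (S.toFinset ∪ O)
    refine ⟨F', S, ?_, hst', h8, hcard, hfl⟩
    have hsum := hS.sum_length
    have h₁ : (S.map fun x => (adj x).length + (adj (F' x)).length).sum =
        ∑ x ∈ S.toFinset, (adj x).length + ∑ x ∈ S.toFinset, (adj (F' x)).length := by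
      rw [← Finset.sum_add_distrib, List.sum_toFinset _ hst'.sched.nodup]
    have h₂ : ∑ x ∈ S.toFinset, (adj x).length ≤ ∑ x, (adj x).length :=
      Finset.sum_le_sum_of_subset (Finset.subset_univ _)
    have h₃ : ∑ x ∈ S.toFinset, (adj (F' x)).length ≤ ∑ x, (adj x).length := by
      rw [← Finset.sum_image (f := fun x => (adj x).length) (g := F')]
      · exact Finset.sum_le_sum_of_subset (Finset.subset_univ _)
      · intro x hx y hy
        exact hst'.sched.injOn (by simpa using hx) (by simpa using hy)
    omega

/-! ### Numbering the paths -/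

theorem Stage.mem_sched_iff (hS : Setting W G I O adj inp out) (h : Schedule G I O F S)
    (hlen : inp.length + S.length = n) (x : Fin n) : x ∈ S ↔ x ∉ O := by
  refine ⟨fun hx => h.notMem_out hx, fun hx => ?_⟩
  have hc := Stage.card_processed hS h
  have : S.toFinset ∪ O = Finset.univ := by
    rw [← Finset.card_eq_iff_eq_univ, hc, hlen, Fintype.card_fin]
  have hx' : x ∈ S.toFinset ∪ O := by rw [this]; simp
  simpa [hx] using hx'

/-- By counting, every vertex outside of `I` is a value of `F`. -/
theorem Stage.exists_pred (hS : Setting W G I O adj inp out) (h : Schedule G I O F S)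
    (hlen : inp.length + S.length = n) {y : Fin n} (hy : y ∉ I) : ∃ x ∈ S, F x = y := by
  have hsub : S.toFinset.image F ⊆ Iᶜ := by
    intro z hz
    simp only [Finset.mem_image, List.mem_toFinset] at hz
    obtain ⟨x, hx, rfl⟩ := hz
    simpa using h.succ_notMem_inp hx
  have hcard : (S.toFinset.image F).card = S.length := by
    rw [Finset.card_image_of_injOn, List.toFinset_card_of_nodup h.nodup]
    intro x hx y hy
    exact h.injOn (by simpa using hx) (by simpa using hy)
  have heq := Finset.eq_of_subset_of_card_le hsub
    (by rw [hcard, Finset.card_compl, hS.card_inp, Fintype.card_fin]; omega)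
  have : y ∈ S.toFinset.image F := by rw [heq]; simpa using hy
  simpa using this

/-- Arrays `5` and `6` hold path numbers and positions, as far as these are determined by the inputs
and by the values of `F` on `A`. -/
structure Labelled (inp : List (Fin n)) (F : Fin n → Fin n) (A : List (Fin n))
    (mem : ℕ → ℕ → ℕ) : Prop where
  path_lt : ∀ x : Fin n, mem 5 x < inp.length
  pos_le : ∀ x : Fin n, mem 6 x ≤ A.length
  start : ∀ (p : ℕ) (hp : p < inp.length),
    mem 5 (inp[p] : Fin n) = p ∧ mem 6 (inp[p] : Fin n) = 0
  step : ∀ x ∈ A, mem 5 (F x) = mem 5 x ∧ mem 6 (F x) = mem 6 x + 1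

/-- A vertex is determined by its path and its position: position `0` is taken only by inputs, and
positive positions are inherited from the predecessor. -/
theorem Labelled.injective (hS : Setting W G I O adj inp out) (hsch : Schedule G I O F S)
    (hlen : inp.length + S.length = n) {mem : ℕ → ℕ → ℕ} (h : Labelled inp F S mem) {x y : Fin n}
    (h5 : mem 5 x = mem 5 y) (h6 : mem 6 x = mem 6 y) : x = y := by
  have hstart : ∀ z : Fin n, mem 6 z = 0 → ∃ hz : mem 5 z < inp.length, z = inp[mem 5 z] := by
    intro z hz
    by_cases hzI : z ∈ I
    · obtain ⟨p, hp, rfl⟩ := List.getElem_of_mem ((hS.mem_inp z).2 hzI)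
      refine ⟨h.path_lt _, ?_⟩
      simp only [(h.start p hp).1]
    · obtain ⟨w, hw, rfl⟩ := Stage.exists_pred hS hsch hlen hzI
      have := (h.step w hw).2
      omega
  have hpred : ∀ z : Fin n, mem 6 z ≠ 0 → ∃ w ∈ S, F w = z := by
    intro z hz
    refine Stage.exists_pred hS hsch hlen fun hzI => ?_
    obtain ⟨p, hp, rfl⟩ := List.getElem_of_mem ((hS.mem_inp z).2 hzI)
    exact hz (h.start p hp).2
  induction hd : mem 6 x generalizing x y with
  | zero =>
    obtain ⟨_, h₁⟩ := hstart x hd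
    obtain ⟨_, h₂⟩ := hstart y (by omega)
    rw [h₁, h₂]
    simp only [h5]
  | succ d ih =>
    obtain ⟨x', hx', rfl⟩ := hpred x (by omega)
    obtain ⟨y', hy', rfl⟩ := hpred y (by omega)
    have hx := h.step x' hx'
    have hy := h.step y' hy'
    rw [ih (x := x') (y := y') (by omega) (by omega) (by omega)]

/-- Number the inputs and carry the numbers along the paths.  Reverse processing order guarantees
that `x` is treated before `F x`. -/
def labelPaths : Prog :=
  .seq (.assign 3 (.lit 0)) <|
  .seq (forLoop 3 1 <|
    .seq (.assign 4 (.load 2 (.reg 3))) (.store 5 (.reg 4) (.reg 3))) <|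
  .seq (.assign 3 (.reg 1)) <|
  forLoop 3 0 <|
    .seq (.assign 4 (.load 12 (.sub (.add (.reg 0) (.reg 1)) (.add (.reg 3) (.lit 1))))) <|
    .seq (.assign 5 (.load 4 (.reg 4))) <|
    .seq (.store 5 (.reg 5) (.load 5 (.reg 4))) <|
    .store 6 (.reg 5) (.add (.load 6 (.reg 4)) (.lit 1))

/-- The effect of treating the next vertex `S[d]`: no label written before is overwritten, because
`F` is injective with values outside of `I`, and none is used before it is written. -/
theorem Labelled.next {mem mem' : ℕ → ℕ → ℕ} (hS : Setting W G I O adj inp out)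
    (hsch : Schedule G I O F S) {d : ℕ} (hd : d < S.length) (h : Labelled inp F (S.take d) mem)
    (h5 : mem' 5 = Function.update (mem 5) (F S[d]) (mem 5 S[d]))
    (h6 : mem' 6 = Function.update (mem 6) (F S[d]) (mem 6 S[d] + 1)) :
    Labelled inp F (S.take (d + 1)) mem' := by
  have hmem : S[d] ∈ S := List.getElem_mem hd
  have hI : F S[d] ∉ I := hsch.succ_notMem_inp hmem
  have hle : (S.take (d + 1)).length = (S.take d).length + 1 := by simp; omega
  have hne : ∀ {a b : Fin n}, a ≠ b → (a : ℕ) ≠ b := fun h h' => h (Fin.ext h')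
  have h5' : ∀ {z}, z ≠ F S[d] → mem' 5 z = mem 5 z := fun hz => by
    rw [h5, Function.update_of_ne (hne hz)]
  have h6' : ∀ {z}, z ≠ F S[d] → mem' 6 z = mem 6 z := fun hz => by
    rw [h6, Function.update_of_ne (hne hz)]
  constructor
  · intro x
    by_cases hx : x = F S[d]
    · rw [hx, h5, Function.update_self]
      exact h.path_lt _
    · rw [h5' hx]
      exact h.path_lt x
  · intro x
    rw [hle]
    by_cases hx : x = F S[d]
    · rw [hx, h6, Function.update_self]
      have := h.pos_le S[d]
      omega
    · rw [h6' hx]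
      have := h.pos_le x
      omega
  · intro p hp
    have hx : inp[p] ≠ F S[d] := by
      intro he
      rw [← he] at hI
      exact hI ((hS.mem_inp _).1 (List.getElem_mem hp))
    rw [h5' hx, h6' hx]
    exact h.start p hp
  · intro x hx
    rw [List.mem_take_succ hd] at hx
    rcases hx with hx | rfl
    · have hxS := List.mem_of_mem_take hx
      have h₁ : F x ≠ F S[d] := by
        intro he
        have := hsch.injOn hxS hmem he
        rw [this] at hx
        exact hsch.nodup.getElem_notMem_take hd hx
      -- `x` comes before `S[d]` in `S` and `F S[d]` after it
      have h₂ : x ≠ F S[d] := by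
        rintro rfl
        have := hsch.idxOf_lt hmem (.inl rfl) (hsch.succ_ne hmem)
        rw [hsch.nodup.idxOf_getElem] at this
        rw [List.mem_take_iff_getElem] at hx
        obtain ⟨j, hj, he⟩ := hx
        rw [← he, hsch.nodup.idxOf_getElem] at this
        omega
      rw [h5' h₁, h6' h₁, h5' h₂, h6' h₂]
      exact h.step x hx
    · have h₂ : S[d] ≠ F S[d] := (hsch.succ_ne hmem).symm
      rw [h5' h₂, h6' h₂, h5, h6, Function.update_self, Function.update_self]
      exact ⟨rfl, rfl⟩

theorem WP.labelPaths (hS : Setting W G I O adj inp out) {s : State} (hin : Input adj inp out s)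
    (hst : Stage G I O adj inp out F S s.mem) (hlen : inp.length + S.length = n)
    (hpos : 0 < n → 0 < inp.length) (h5 : s.mem 5 = fun _ => 0) (h6 : s.mem 6 = fun _ => 0) :
    WP W labelPaths s fun t s' => t ≤ 40 * n + 12 ∧ Labelled inp F S s'.mem := by
  have hword := hS.word
  unfold RAM.labelPaths
  simp only [WP.seq_iff, WP.assign_iff, Expr.Fits, Expr.val_lit, Expr.val_reg, Expr.cost]
  refine ⟨by omega, ?_⟩
  refine WP.forLoop 0 inp.length (fun i t s' => t = 14 * i ∧
    (∀ x : Fin n, s'.mem 5 x < inp.length) ∧ ∀ (p : ℕ) (hp : p < inp.length), p < i →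
    s'.mem 5 (inp[p] : Fin n) = p) (by omega) (by decide) (by decide)
    (by decide) (by simp) (by simp [hin.reg1]) (by omega) ?_ ?_ ?_
  · refine ⟨rfl, fun x => ?_, by omega⟩
    rw [State.setReg_mem, h5]
    exact hpos (x.pos)
  · rintro i t s' - hi hr hF ⟨ht, hI, hI'⟩
    have hin' := (hin.of_frame (p := .assign 3 (.lit 0)) (s' := s.setReg 3 0)
      ⟨fun r hr => by simp_all [Prog.regs], fun _ _ => rfl⟩ (by decide)).of_frame hF (by decide)
    have hx := hin'.inp i hi
    simp only [WP.seq_iff, WP.assign_iff, WP.store_iff, Expr.Fits, Expr.val_reg, Expr.val_load,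
      Expr.cost, hr, hx, State.setReg_reg, State.setMem_mem, State.setReg_mem, if_pos,
      Nat.reduceEqDiff, if_false]
    refine ⟨by omega, by omega, by omega, by omega, fun x => ?_, fun p hp hpi => ?_⟩
    · by_cases hw : (x : ℕ) = (inp[i] : Fin n)
      · rw [hw, Function.update_self]; exact hi
      · rw [Function.update_of_ne hw]; exact hI x
    · by_cases hpi' : p = i
      · subst hpi'; rw [Function.update_self]
      · have : (inp[p] : ℕ) ≠ (inp[i] : Fin n) := fun h =>
          hpi' ((hS.nodup_inp.getElem_inj_iff).1 (Fin.ext h))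
        rw [Function.update_of_ne this]
        exact hI' p hp (by omega)
  rintro t s₁ hF hr ⟨ht, hI, hI'⟩
  have hin₁ := (hin.of_frame (p := .assign 3 (.lit 0)) (s' := s.setReg 3 0)
    ⟨fun r hr => by simp_all [Prog.regs], fun _ _ => rfl⟩ (by decide)).of_frame hF (by decide)
  have hreg1 := hin₁.reg1
  have hm : ∀ a, a ≠ 5 → s₁.mem a = s.mem a := by
    intro a ha
    rw [hF.mem a (by simpa [Prog.arrays] using ha), State.setReg_mem]
  refine ⟨by omega, ?_⟩
  refine WP.forLoop inp.length n (fun i t s' => t = 30 * (i - inp.length) ∧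
    Labelled inp F (S.take (i - inp.length)) s'.mem) (by omega) (by decide) (by decide)
    (by decide) (by simp [hreg1]) (by simp [hin₁.reg0]) (by omega) ?_ ?_ ?_
  · refine ⟨by simp, hI, fun x => ?_, fun p hp => ⟨hI' p hp hp, ?_⟩, by simp⟩
    · rw [State.setReg_mem, hm 6 (by decide), h6]; simp
    · rw [State.setReg_mem, hm 6 (by decide), h6]
  · rintro i t s' hki hi hr hF' ⟨ht, hL⟩
    obtain ⟨d, rfl⟩ : ∃ d, i = inp.length + d := ⟨i - inp.length, by omega⟩
    have hd : d < S.length := by omega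
    have hin' := (hin₁.of_frame (p := .assign 3 (.lit 0)) (s' := s₁.setReg 3 (s₁.reg 1))
      ⟨fun r hr => by simp_all [Prog.regs], fun _ _ => rfl⟩ (by decide)).of_frame hF' (by decide)
    have h0' := hin'.reg0
    have h1' := hin'.reg1
    have hm' : ∀ a, a ≠ 5 → a ≠ 6 → s'.mem a = s.mem a := by
      intro a ha ha'
      rw [hF'.mem a (by simp [Prog.arrays, ha, ha']), State.setReg_mem, hm a ha]
    have hidx : n + inp.length - (inp.length + d + 1) = inp.length + (S.length - 1 - d) := by omega
    have hord := hst.ord (S.length - 1 - d) (by rw [List.length_reverse]; omega)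
    have hget : S.reverse[S.length - 1 - d]'(by rw [List.length_reverse]; omega) = S[d] := by
      rw [List.getElem_reverse]
      congr 1
      omega
    rw [hget] at hord
    have hsucc := hst.succ S[d] (List.getElem_mem hd)
    rw [Nat.add_sub_cancel_left] at hL ht
    have hpl := hL.path_lt S[d]
    have hposl := hL.pos_le S[d]
    have hne : (S[d] : ℕ) ≠ F S[d] := fun h =>
      hst.sched.succ_ne (List.getElem_mem hd) (Fin.ext h).symm
    have htl : (S.take d).length ≤ n := by rw [List.length_take]; omega
    simp only [WP.seq_iff, WP.assign_iff, WP.store_iff, Expr.Fits, Expr.val_reg, Expr.val_load,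
      Expr.val_add, Expr.val_sub, Expr.val_lit, Expr.cost, hr, h0', h1', hidx,
      hm' 12 (by decide) (by decide), hord, hm' 4 (by decide) (by decide), hsucc,
      State.setReg_reg, State.setMem_reg, State.setMem_mem, State.setReg_mem, if_pos,
      Nat.reduceEqDiff, if_false]
    refine ⟨by omega, by omega, by omega, by omega, by omega, by omega, by omega, ?_⟩
    have hd' : inp.length + d + 1 - inp.length = d + 1 := by omega
    rw [hd']
    exact hL.next hS hst.sched hd (by simp) (by simp)
  · rintro t' s₂ hF' hr' ⟨ht', hL⟩
    have hn : n - inp.length = S.length := by omega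
    rw [hn, List.take_length] at hL
    exact ⟨by omega, hL⟩

end RAM

/-! ### The table of first vertices -/

/-- The cell `e` of the table describes the first vertex of path `q` in the set `T`: it is `y + 1` if
this vertex is `y`, and `0` if there is none. -/
def IsFirst {n : ℕ} (path pos : Fin n → ℕ) (T : Fin n → Prop) (q e : ℕ) : Prop :=
  (e = 0 ∧ ∀ y, path y = q → ¬ T y) ∨
    ∃ y : Fin n, e = y + 1 ∧ path y = q ∧ T y ∧ ∀ z, path z = q → T z → pos y ≤ pos z

namespace IsFirst

variable {n : ℕ} {path pos : Fin n → ℕ} {T T' : Fin n → Prop} {q e e' : ℕ}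

theorem congr (h : IsFirst path pos T q e) (hT : ∀ z, T z ↔ T' z) : IsFirst path pos T' q e := by
  obtain rfl : T = T' := funext fun z => propext (hT z)
  exact h

theorem le (h : IsFirst path pos T q e) : e ≤ n := by
  rcases h with ⟨rfl, -⟩ | ⟨y, rfl, -⟩ <;> omega

theorem eq_zero_iff (h : IsFirst path pos T q e) : e = 0 ↔ ∀ y, path y = q → ¬ T y := by
  rcases h with ⟨he, hy⟩ | ⟨y, he, hq, hy, -⟩
  · exact ⟨fun _ => hy, fun _ => he⟩
  · exact ⟨fun h => by omega, fun h => (h y hq hy).elim⟩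

theorem eq_succ_iff (hinj : ∀ x y, path x = path y → pos x = pos y → x = y)
    (h : IsFirst path pos T q e) (y : Fin n) :
    e = y + 1 ↔ path y = q ∧ T y ∧ ∀ z, path z = q → T z → pos y ≤ pos z := by
  rcases h with ⟨he, hn⟩ | ⟨x, he, hq, hx, hmin⟩
  · exact ⟨fun h => by omega, fun h => (hn y h.1 h.2.1).elim⟩
  · constructor
    · intro h
      obtain rfl : x = y := Fin.ext (by omega)
      exact ⟨hq, hx, hmin⟩
    · rintro ⟨hq', hy, hmin'⟩
      rw [he, hinj x y (hq.trans hq'.symm) (le_antisymm (hmin y hq' hy) (hmin' x hq hx))]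

theorem union_of_none (h : IsFirst path pos T q e) (h' : IsFirst path pos T' q 0) :
    IsFirst path pos (fun z => T z ∨ T' z) q e := by
  have hn := h'.eq_zero_iff.1 rfl
  rcases h with ⟨he, hne⟩ | ⟨x, he, hq, hx, hmin⟩
  · exact .inl ⟨he, fun y hy => not_or.2 ⟨hne y hy, hn y hy⟩⟩
  · exact .inr ⟨x, he, hq, .inl hx, fun z hz hT => hmin z hz (hT.resolve_right (hn z hz))⟩

theorem union_of_le {x y : Fin n} (h : IsFirst path pos T q (x + 1))
    (h' : IsFirst path pos T' q (y + 1)) (hle : pos x ≤ pos y) :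
    IsFirst path pos (fun z => T z ∨ T' z) q (x + 1) := by
  rcases h with ⟨he, -⟩ | ⟨x', he, hq, hx, hmin⟩
  · omega
  rcases h' with ⟨he', -⟩ | ⟨y', he', hq', hy, hmin'⟩
  · omega
  obtain rfl : x = x' := Fin.ext (by omega)
  obtain rfl : y = y' := Fin.ext (by omega)
  exact .inr ⟨x, rfl, hq, .inl hx, fun z hz hT => hT.elim (hmin z hz) fun h =>
    hle.trans (hmin' z hz h)⟩

theorem union_comm (h : IsFirst path pos (fun z => T z ∨ T' z) q e) :
    IsFirst path pos (fun z => T' z ∨ T z) q e :=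
  h.congr fun _ => or_comm

end IsFirst

namespace RAM

variable {n : ℕ} {G : SimpleGraph (Fin n)} {I O : Finset (Fin n)}
  {adj : Fin n → List (Fin n)} {inp out : List (Fin n)} {W : ℕ}
  {F : Fin n → Fin n} {S : List (Fin n)}

/-- Row `x` of the table describes the first vertices of all paths in the set `T`. -/
def Row (inp : List (Fin n)) (mem : ℕ → ℕ → ℕ) (x : Fin n) (T : Fin n → Prop) : Prop :=
  ∀ q < inp.length,
    IsFirst (fun z => mem 5 z) (fun z => mem 6 z) T q (mem 7 (x * inp.length + q))

theorem mul_add_eq_iff {k a b p q : ℕ} (hp : p < k) (hq : q < k) :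
    a * k + p = b * k + q ↔ a = b ∧ p = q := by
  constructor
  · intro h
    have h₁ : (a * k + p) / k = (b * k + q) / k := by rw [h]
    have hk : 0 < k := by omega
    rw [Nat.add_comm, Nat.add_comm (b * k), Nat.add_mul_div_right _ _ hk,
      Nat.add_mul_div_right _ _ hk, Nat.div_eq_of_lt hp, Nat.div_eq_of_lt hq] at h₁
    have h₂ : a = b := by omega
    subst h₂
    omega
  · rintro ⟨rfl, rfl⟩
    rfl

/-- Merge the row of the vertex in register `8` into the row of the vertex in register `4`. -/
def merge : Prog :=
  .seq (.assign 9 (.lit 0)) <|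
  forLoop 9 1 <|
    .seq (.assign 10 (.load 7 (.add (.mul (.reg 8) (.reg 1)) (.reg 9)))) <|
    .seq (.assign 11 (.load 7 (.add (.mul (.reg 4) (.reg 1)) (.reg 9)))) <|
    .ite (.reg 10)
      (.ite (.reg 11)
        (.ite (.lt (.load 6 (.sub (.reg 10) (.lit 1))) (.load 6 (.sub (.reg 11) (.lit 1))))
          (.store 7 (.add (.mul (.reg 4) (.reg 1)) (.reg 9)) (.reg 10)) .skip)
        (.store 7 (.add (.mul (.reg 4) (.reg 1)) (.reg 9)) (.reg 10)))
      .skip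

theorem Setting.cell_lt (hS : Setting W G I O adj inp out) (x : Fin n) {q : ℕ}
    (hq : q < inp.length) : x * inp.length + q < n * n := by
  have hk := hS.length_inp_le
  have hx := x.2
  calc x * inp.length + q < x * inp.length + inp.length := by omega
    _ = (x + 1) * inp.length := by ring
    _ ≤ n * n := Nat.mul_le_mul hx hk

/-- Merging row `y` into row `x` forms the union of the described sets.  The case `y = x` is
permitted: cell `i` is read before it is written. -/
theorem WP.merge (hS : Setting W G I O adj inp out) {s : State} (hin : Input adj inp out s)
    {x y : Fin n} (hx : s.reg 4 = x) (hy : s.reg 8 = y) {T T' : Fin n → Prop}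
    (hT : Row inp s.mem x T) (hT' : Row inp s.mem y T')
    (hpos : ∀ z : Fin n, s.mem 6 z ≤ n) :
    WP W merge s fun t s' => t ≤ 43 * inp.length + 6 ∧
      Row inp s'.mem x (fun z => T z ∨ T' z) ∧
      ∀ z : Fin n, z ≠ x → ∀ q < inp.length,
        s'.mem 7 (z * inp.length + q) = s.mem 7 (z * inp.length + q) := by
  have hword := hS.word
  have hk := hS.length_inp_le
  unfold RAM.merge
  simp only [WP.seq_iff, WP.assign_iff, Expr.Fits, Expr.val_lit, Expr.cost]
  refine ⟨by omega, ?_⟩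
  refine WP.forLoop 0 inp.length (fun i t s' => t ≤ 43 * i ∧
    (∀ q < i, IsFirst (fun z => s.mem 5 z) (fun z => s.mem 6 z) (fun z => T z ∨ T' z) q
      (s'.mem 7 (x * inp.length + q))) ∧
    ∀ z : Fin n, ∀ q < inp.length, (z = x → i ≤ q) →
      s'.mem 7 (z * inp.length + q) = s.mem 7 (z * inp.length + q)) (by omega) (by decide)
    (by decide) (by decide) (by simp) (by simp [hin.reg1]) (by omega) ?_ ?_ ?_
  · simp
  · rintro i t s' - hi hr hF ⟨ht, hI, hI'⟩
    have hreg : ∀ r, r ≠ 9 → r ≠ 10 → r ≠ 11 → s'.reg r = s.reg r := by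
      intro r h9 h10 h11
      rw [hF.reg r (by simp [Prog.regs, h9, h10, h11])]
      simp [h9]
    have h1 : s'.reg 1 = inp.length := by
      rw [hreg 1 (by decide) (by decide) (by decide), hin.reg1]
    have h4 : s'.reg 4 = x := by rw [hreg 4 (by decide) (by decide) (by decide), hx]
    have h8 : s'.reg 8 = y := by rw [hreg 8 (by decide) (by decide) (by decide), hy]
    have h6 : s'.mem 6 = s.mem 6 := by rw [hF.mem 6 (by decide), State.setReg_mem]
    have hcx := hI' x i hi (fun _ => le_rfl)
    have hcy := hI' y i hi (fun _ => le_rfl)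
    have hx₁ := hS.cell_lt x hi
    have hy₁ := hS.cell_lt y hi
    have hfx := hT i hi
    have hfy := hT' i hi
    set a := s.mem 7 (x * inp.length + i) with ha
    set b := s.mem 7 (y * inp.length + i) with hb
    have han := hfx.le
    have hbn := hfy.le
    have hstore : ∀ m : ℕ → ℕ,
        m = Function.update (s'.mem 7) (x * inp.length + i) b →
        IsFirst (fun z => s.mem 5 z) (fun z => s.mem 6 z) (fun z => T z ∨ T' z) i b →
        (∀ q < i + 1, IsFirst (fun z => s.mem 5 z) (fun z => s.mem 6 z) (fun z => T z ∨ T' z) q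
          (m (x * inp.length + q))) ∧
        ∀ z : Fin n, ∀ q < inp.length, (z = x → i + 1 ≤ q) →
          m (z * inp.length + q) = s.mem 7 (z * inp.length + q) := by
      rintro m rfl hfirst
      refine ⟨fun q hq => ?_, fun z q hq hz => ?_⟩
      · by_cases hqi : q = i
        · subst hqi
          rwa [Function.update_self]
        · rw [Function.update_of_ne (by omega)]
          exact hI q (by omega)
      · rw [Function.update_of_ne]
        · exact hI' z q hq fun h => by have := hz h; omega
        · rw [Ne, mul_add_eq_iff hq hi]
          rintro ⟨h₁, rfl⟩
          omega
    have hkeep : IsFirst (fun z => s.mem 5 z) (fun z => s.mem 6 z) (fun z => T z ∨ T' z) i a →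
        (∀ q < i + 1, IsFirst (fun z => s.mem 5 z) (fun z => s.mem 6 z) (fun z => T z ∨ T' z) q
          (s'.mem 7 (x * inp.length + q))) ∧
        ∀ z : Fin n, ∀ q < inp.length, (z = x → i + 1 ≤ q) →
          s'.mem 7 (z * inp.length + q) = s.mem 7 (z * inp.length + q) := by
      intro hfirst
      refine ⟨fun q hq => ?_, fun z q hq hz => hI' z q hq fun h => by have := hz h; omega⟩
      by_cases hqi : q = i
      · subst hqi
        rwa [hcx]
      · exact hI q (by omega)
    simp only [WP.seq_iff, WP.assign_iff, WP.ite_iff, WP.store_iff, WP.skip_iff, Expr.Fits,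
      Expr.val_reg, Expr.val_load, Expr.val_add, Expr.val_sub, Expr.val_mul, Expr.val_lit,
      Expr.cost, hr, h1, h4, h8, hcx, hcy, h6, State.setReg_reg, State.setReg_mem, State.setMem_mem,
      if_pos, Nat.reduceEqDiff, if_false, Expr.val_lt_ne_zero_iff, Expr.val_lt_eq_zero_iff]
    refine ⟨by omega, by omega, by omega, fun hb0 => ?_, fun hb0 => ?_⟩
    · obtain ⟨y', hy'⟩ : ∃ y' : Fin n, b = y' + 1 := ⟨⟨b - 1, by omega⟩, by simp; omega⟩
      have hpy := hpos y'
      have hpy' : s.mem 6 (b - 1) = s.mem 6 y' := by rw [hy', Nat.add_sub_cancel]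
      refine ⟨by omega, fun ha0 => ?_, fun ha0 => ?_⟩
      · obtain ⟨x', hx'⟩ : ∃ x' : Fin n, a = x' + 1 := ⟨⟨a - 1, by omega⟩, by simp; omega⟩
        have hpx := hpos x'
        have hpx' : s.mem 6 (a - 1) = s.mem 6 x' := by rw [hx', Nat.add_sub_cancel]
        rw [hpx', hpy']
        refine ⟨by omega, fun hlt => ?_, fun hlt => ?_⟩
        · refine ⟨by omega, by omega, by omega, hstore _ rfl ?_⟩
          rw [hy'] at hfy ⊢
          rw [hx'] at hfx
          exact (hfy.union_of_le hfx hlt.le).union_comm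
        · refine ⟨by omega, hkeep ?_⟩
          rw [hy'] at hfy
          rw [hx'] at hfx ⊢
          exact hfx.union_of_le hfy hlt
      · refine ⟨by omega, by omega, by omega, hstore _ rfl ?_⟩
        rw [ha0] at hfx
        exact (hfy.union_of_none hfx).union_comm
    · refine ⟨by omega, hkeep ?_⟩
      rw [hb0] at hfy
      exact hfx.union_of_none hfy
  · rintro t s' hF hr ⟨ht, hI, hI'⟩
    refine ⟨by omega, fun q hq => ?_, fun z hz q hq => hI' z q hq fun h => (hz h).elim⟩
    rw [hF.mem 5 (by decide), hF.mem 6 (by decide)]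
    exact hI q hq

theorem Row.of_eq {mem mem' : ℕ → ℕ → ℕ} {x : Fin n} {T : Fin n → Prop} (h : Row inp mem x T)
    (h5 : mem' 5 = mem 5) (h6 : mem' 6 = mem 6)
    (h7 : ∀ q < inp.length, mem' 7 (x * inp.length + q) = mem 7 (x * inp.length + q)) :
    Row inp mem' x T := by
  intro q hq
  rw [h5, h6, h7 q hq]
  exact h q hq

theorem Row.congr {mem : ℕ → ℕ → ℕ} {x : Fin n} {T T' : Fin n → Prop} (h : Row inp mem x T)
    (hT : ∀ z, T z ↔ T' z) : Row inp mem x T' :=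
  fun q hq => (h q hq).congr hT

/-- Merge the rows of `F x` and of its neighbours into the row of the vertex `x` in register `4`. -/
def closeRow : Prog :=
  .seq (.assign 5 (.load 4 (.reg 4))) <|
  .seq (.assign 8 (.reg 5)) <|
  .seq merge <|
  nbrLoop 5 13 14 8 merge

/-- If the rows of `v = F x` and of its neighbours other than `x` are final, and the row of `x` knows
`x` alone, then the row of `x` becomes final. -/
theorem WP.closeRow (hS : Setting W G I O adj inp out) {s : State} (hin : Input adj inp out s)
    {x v : Fin n} (hx : s.reg 4 = x) (hv : s.mem 4 x = v) (hvx : v ≠ x) {le : Fin n → Fin n → Prop}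
    (hrow : Row inp s.mem x fun z => z = x)
    (hdone : ∀ y, y = v ∨ y ∈ adj v → y ≠ x → Row inp s.mem y (le y))
    (hpos : ∀ z : Fin n, s.mem 6 z ≤ n)
    (hle : ∀ z, le x z ↔ z = x ∨ le v z ∨ ∃ y ∈ adj v, y ≠ x ∧ le y z) :
    WP W closeRow s fun t s' =>
      t ≤ (43 * inp.length + 17) * (adj v).length + 43 * inp.length + 23 ∧
      Row inp s'.mem x (le x) ∧ ∀ z : Fin n, z ≠ x → ∀ q < inp.length,
        s'.mem 7 (z * inp.length + q) = s.mem 7 (z * inp.length + q) := by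
  have hword := hS.word
  unfold RAM.closeRow
  simp only [WP.seq_iff, WP.assign_iff, Expr.Fits, Expr.val_reg, Expr.val_load, Expr.cost, hx, hv,
    State.setReg_reg, if_pos]
  refine ⟨by omega, by omega, ?_⟩
  have hin₀ : Input adj inp out ((s.setReg 5 v).setReg 8 v) :=
    hin.of_frame (p := .seq (.assign 5 (.lit 0)) (.assign 8 (.lit 0)))
      ⟨fun r hr => by simp_all [Prog.regs], fun _ _ => rfl⟩ (by decide)
  refine (WP.merge (x := x) (y := v) (T := fun z => z = x) (T' := le v) hS hin₀ (by simp [hx])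
    (by simp) hrow (hdone v (.inl rfl) hvx) hpos).conseq ?_
  rintro t₁ s₁ hF₁ ⟨ht₁, hrow₁, hother₁⟩
  have hin₁ := hin₀.of_frame hF₁ (by decide)
  have h5₁ : s₁.mem 5 = s.mem 5 := by rw [hF₁.mem 5 (by decide)]; rfl
  have h6₁ : s₁.mem 6 = s.mem 6 := by rw [hF₁.mem 6 (by decide)]; rfl
  have hx₁ : s₁.reg 4 = x := by rw [hF₁.reg 4 (by decide)]; simp [hx]
  refine WP.nbrLoop hS hin₁ (by decide) v (by rw [hF₁.reg 5 (by decide)]; simp)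
    (by decide) (by decide) (by decide) (by decide)
    (fun i t mem => t ≤ (43 * inp.length + 17) * i ∧
      Row inp mem x (fun z => (z = x ∨ le v z) ∨ ∃ y ∈ (adj v).take i, y ≠ x ∧ le y z) ∧
      ∀ z : Fin n, z ≠ x → ∀ q < inp.length,
        mem 7 (z * inp.length + q) = s.mem 7 (z * inp.length + q)) ?_ ?_ ?_
  · exact ⟨by simp, hrow₁.congr fun z => by simp, hother₁⟩
  · rintro i t s₂ hi hF₂ hy ⟨ht₂, hrow₂, hother₂⟩
    have hin₂ := hin₁.of_frame hF₂ (by decide)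
    have h5₂ : s₂.mem 5 = s.mem 5 := by rw [hF₂.mem 5 (by decide), h5₁]
    have h6₂ : s₂.mem 6 = s.mem 6 := by rw [hF₂.mem 6 (by decide), h6₁]
    have hx₂ : s₂.reg 4 = x := by rw [hF₂.reg 4 (by decide), hx₁]
    have hyadj : (adj v)[i] ∈ adj v := List.getElem_mem hi
    have hmul : (43 * inp.length + 17) * (i + 1) =
      (43 * inp.length + 17) * i + (43 * inp.length + 17) := by ring
    rw [hmul]
    have htake : ∀ z, (∃ y ∈ (adj v).take (i + 1), y ≠ x ∧ le y z) ↔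
        (∃ y ∈ (adj v).take i, y ≠ x ∧ le y z) ∨ ((adj v)[i] ≠ x ∧ le (adj v)[i] z) := by
      intro z
      simp only [List.mem_take_succ hi, or_and_right, exists_or, exists_eq_left]
    -- the row of `x` itself may be merged into itself, which has no effect
    by_cases hyx : (adj v)[i] = x
    · refine (WP.merge hS hin₂ hx₂ hy hrow₂ (by rw [hyx]; exact hrow₂)
        (by rw [h6₂]; exact hpos)).conseq ?_
      rintro t₃ s₃ - ⟨ht₃, hrow₃, hother₃⟩
      refine ⟨by omega, hrow₃.congr fun z => ?_, fun z hz q hq =>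
        (hother₃ z hz q hq).trans (hother₂ z hz q hq)⟩
      simp only [htake, hyx, ne_eq, not_true_eq_false, false_and, or_false, or_self]
    · refine (WP.merge hS hin₂ hx₂ hy hrow₂ ((hdone _ (.inr hyadj) hyx).of_eq h5₂ h6₂
        (hother₂ _ hyx)) (by rw [h6₂]; exact hpos)).conseq ?_
      rintro t₃ s₃ - ⟨ht₃, hrow₃, hother₃⟩
      refine ⟨by omega, hrow₃.congr fun z => ?_, fun z hz q hq =>
        (hother₃ z hz q hq).trans (hother₂ z hz q hq)⟩
      simp only [htake, hyx, ne_eq, not_false_eq_true, true_and, or_assoc]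
  · rintro t s₂ hF₂ ⟨ht₂, hrow₂, hother₂⟩
    refine ⟨by omega, hrow₂.congr fun z => ?_, hother₂⟩
    rw [List.take_length, hle]
    tauto

/-- Fill the rows of the table in processing order. -/
def fillTable : Prog :=
  .seq (.assign 3 (.lit 0)) <|
  forLoop 3 0 <|
    .seq (.assign 4 (.load 12 (.reg 3))) <|
    .seq (.store 7 (.add (.mul (.reg 4) (.reg 1)) (.load 5 (.reg 4))) (.add (.reg 4) (.lit 1))) <|
    .ite (.lt (.reg 3) (.reg 1)) .skip closeRow

/-- In the processing order, the vertices that are merged into the row of `x` precede `x`. -/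
theorem Stage.mem_take_of_step (hS : Setting W G I O adj inp out) (h : Schedule G I O F S)
    {i : ℕ} (hi : i < (out ++ S.reverse).length) (hiO : inp.length ≤ i) {y : Fin n}
    (hy : y = F (out ++ S.reverse)[i] ∨ G.Adj y (F (out ++ S.reverse)[i]))
    (hne : y ≠ (out ++ S.reverse)[i]) : y ∈ (out ++ S.reverse).take i := by
  have hlo := hS.length_out
  have hi' : i < out.length + S.length := by simpa using hi
  have hget : (out ++ S.reverse)[i] = S[S.length - 1 - (i - out.length)]'(by omega) := by
    rw [List.getElem_append_right (by omega), List.getElem_reverse]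
  rw [hget] at hy hne
  have hmem : S[S.length - 1 - (i - out.length)]'(by omega) ∈ S := List.getElem_mem _
  rcases h.processed_of_step hmem hy with hyS | hyO
  · have hlt := h.idxOf_lt hmem hy hne
    rw [h.nodup.idxOf_getElem] at hlt
    have hidx := List.idxOf_lt_length_of_mem hyS
    rw [List.mem_take_iff_getElem]
    refine ⟨out.length + (S.length - 1 - S.idxOf y), by simp; omega, ?_⟩
    rw [List.getElem_append_right (by omega), List.getElem_reverse]
    have : S.length - 1 - (out.length + (S.length - 1 - S.idxOf y) - out.length) = S.idxOf y := by
      omega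
    simp only [this]
    exact List.getElem_idxOf hidx
  · rw [List.take_append, List.mem_append]
    left
    rw [List.take_of_length_le (by omega)]
    exact (hS.mem_out y).2 hyO

theorem WP.fillTable (hS : Setting W G I O adj inp out) {s : State} (hin : Input adj inp out s)
    (hst : Stage G I O adj inp out F S s.mem) (hlen : inp.length + S.length = n)
    (hL : Labelled inp F S s.mem) (h7 : s.mem 7 = fun _ => 0) {le : Fin n → Fin n → Prop}
    (hle_out : ∀ x ∈ O, ∀ z, le x z ↔ z = x)
    (hle : ∀ x ∉ O, ∀ z, le x z ↔
      z = x ∨ le (F x) z ∨ ∃ y ∈ adj (F x), y ≠ x ∧ le y z) :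
    WP W fillTable s fun t s' =>
      t ≤ 27 * n + (43 * inp.length + 23) * (2 * G.edgeSet.ncard + (n - inp.length)) + 6 ∧
      ∀ x, Row inp s'.mem x (le x) := by
  have hword := hS.word
  have hlo := hS.length_out
  have hpos : ∀ z : Fin n, s.mem 6 z ≤ n := fun z => (hL.pos_le z).trans (by omega)
  set L := out ++ S.reverse with hLdef
  have hLlen : L.length = n := by simp [hLdef]; omega
  have hmemS := Stage.mem_sched_iff hS hst.sched hlen
  have hLmem : ∀ x, x ∈ L := by
    intro x
    rw [hLdef, List.mem_append, List.mem_reverse, hS.mem_out, hmemS]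
    tauto
  have hLnd : L.Nodup := by
    rw [hLdef, List.nodup_append]
    refine ⟨hS.nodup_out, List.nodup_reverse.2 hst.sched.nodup, ?_⟩
    rintro a ha b hb rfl
    exact hst.sched.notMem_out (List.mem_reverse.1 hb) ((hS.mem_out a).1 ha)
  have hord : ∀ i (hi : i < L.length), s.mem 12 i = (L[i] : Fin n) := by
    intro i hi
    by_cases hio : i < out.length
    · rw [hst.ord_out i hio]
      simp [hLdef, List.getElem_append_left hio]
    · have := hst.ord (i - inp.length) (by rw [List.length_reverse]; omega)
      rw [Nat.add_sub_cancel' (by omega)] at this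
      rw [this]
      simp only [hLdef]
      rw [List.getElem_append_right (by omega)]
      simp only [hlo]
  have hLO : ∀ i (hi : i < L.length), L[i] ∈ O ↔ i < inp.length := by
    intro i hi
    by_cases hio : i < out.length
    · simp only [hLdef]
      rw [List.getElem_append_left hio, ← hS.mem_out]
      simp; omega
    · simp only [hLdef]
      rw [List.getElem_append_right (by omega)]
      refine iff_of_false (hst.sched.notMem_out (List.mem_reverse.1 (List.getElem_mem _))) (by omega)
  unfold RAM.fillTable
  simp only [WP.seq_iff, WP.assign_iff, Expr.Fits, Expr.val_lit, Expr.cost]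
  refine ⟨by omega, ?_⟩
  refine WP.forLoop 0 n (fun i t s' =>
    t ≤ 27 * i + (43 * inp.length + 23) *
      ∑ x ∈ (L.take i).toFinset \ O, ((adj (F x)).length + 1) ∧
    (∀ x ∈ L.take i, Row inp s'.mem x (le x)) ∧
    ∀ x ∉ L.take i, ∀ q < inp.length, s'.mem 7 (x * inp.length + q) = 0) (by omega) (by decide)
    (by decide) (by decide) (by simp) (by simp [hin.reg0]) (by omega) ?_ ?_ ?_
  · simp [h7]
  · rintro i t s' - hi hr hF ⟨ht, hrows, hzero⟩
    have hin' := (hin.of_frame (p := .assign 3 (.lit 0)) (s' := s.setReg 3 0)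
      ⟨fun r hr => by simp_all [Prog.regs], fun _ _ => rfl⟩ (by decide)).of_frame hF (by decide)
    have hiL : i < L.length := by omega
    have h1' := hin'.reg1
    have hm : ∀ a, a ≠ 7 → s'.mem a = s.mem a := by
      intro a ha
      rw [hF.mem a ?_, State.setReg_mem]
      have : ∀ a, a ∈ (Prog.seq (.assign 4 (.load 12 (.reg 3))) <|
          .seq (.store 7 (.add (.mul (.reg 4) (.reg 1)) (.load 5 (.reg 4)))
            (.add (.reg 4) (.lit 1))) <|
          .ite (.lt (.reg 3) (.reg 1)) .skip RAM.closeRow).arrays → a = 7 := by decide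
      exact fun h => ha (this a (by simpa [Prog.arrays] using h))
    have hx := hord i hiL
    obtain ⟨x, hxdef⟩ : ∃ x, x = L[i] := ⟨_, rfl⟩
    rw [← hxdef] at hx
    have hxnot : x ∉ L.take i := by rw [hxdef]; exact hLnd.getElem_notMem_take hiL
    have hxp := hL.path_lt x
    have hcell := hS.cell_lt x hxp
    simp only [WP.seq_iff, WP.assign_iff, WP.store_iff, WP.ite_iff, WP.skip_iff, Expr.Fits,
      Expr.val_reg, Expr.val_load, Expr.val_add, Expr.val_mul, Expr.val_lit, Expr.cost, hr, h1',
      hm 12 (by decide), hm 5 (by decide), hx, State.setReg_reg, State.setMem_reg,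
      State.setReg_mem, if_pos, Nat.reduceEqDiff, if_false, Expr.val_lt_ne_zero_iff,
      Expr.val_lt_eq_zero_iff, OfNat.one_ne_ofNat]
    set s₁ := (s'.setReg 4 x).setMem 7 (x * inp.length + s.mem 5 x) (x + 1) with hs₁
    have hm₁ : ∀ a, a ≠ 7 → s₁.mem a = s.mem a := by
      intro a ha
      rw [hs₁, State.setMem_mem, if_neg ha, State.setReg_mem, hm a ha]
    have h7₁ : s₁.mem 7 = Function.update (s'.mem 7) (x * inp.length + s.mem 5 x) (x + 1) := by
      rw [hs₁, State.setMem_mem, if_pos rfl, State.setReg_mem]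
    have hother : ∀ z : Fin n, z ≠ x → ∀ q < inp.length,
        s₁.mem 7 (z * inp.length + q) = s'.mem 7 (z * inp.length + q) := by
      intro z hz q hq
      rw [h7₁, Function.update_of_ne]
      rw [Ne, mul_add_eq_iff hq hxp]
      exact fun h => hz (Fin.ext h.1)
    have hrow : Row inp s₁.mem x fun z => z = x := by
      intro q hq
      rw [hm₁ 5 (by decide), hm₁ 6 (by decide), h7₁]
      by_cases hqx : q = s.mem 5 x
      · subst hqx
        rw [Function.update_self]
        exact .inr ⟨x, rfl, rfl, rfl, fun z _ hz => by rw [hz]⟩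
      · refine .inl ⟨?_, fun y hy hyx => hqx (by rw [← hy, hyx])⟩
        rw [Function.update_of_ne (by omega)]
        exact hzero x hxnot q hq
    have hnext : ∀ m : ℕ → ℕ → ℕ, m 5 = s.mem 5 → m 6 = s.mem 6 → Row inp m x (le x) →
        (∀ z : Fin n, z ≠ x → ∀ q < inp.length,
          m 7 (z * inp.length + q) = s'.mem 7 (z * inp.length + q)) →
        (∀ x ∈ L.take (i + 1), Row inp m x (le x)) ∧
        ∀ x ∉ L.take (i + 1), ∀ q < inp.length, m 7 (x * inp.length + q) = 0 := by
      intro m h5 h6 hrx ho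
      constructor
      · intro z hz
        by_cases hzx : z = x
        · rwa [hzx]
        · rw [List.mem_take_succ hiL, ← hxdef] at hz
          exact (hrows z (hz.resolve_right hzx)).of_eq (by rw [h5, hm 5 (by decide)])
            (by rw [h6, hm 6 (by decide)]) (ho z hzx)
      · intro z hz q hq
        rw [List.mem_take_succ hiL, ← hxdef, not_or] at hz
        rw [ho z hz.2 q hq]
        exact hzero z hz.1 q hq
    have hxO := hLO i hiL
    rw [← hxdef] at hxO
    have hins : (L.take (i + 1)).toFinset = insert x (L.take i).toFinset := by
      ext y
      simp only [List.mem_toFinset, List.mem_take_succ hiL, Finset.mem_insert, ← hxdef]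
      tauto
    refine ⟨by omega, by omega, by omega, by omega, fun hio => ?_, fun hio => ?_⟩
    · rw [hins, Finset.insert_sdiff_of_mem _ (hxO.2 hio)]
      refine ⟨by omega, hnext s₁.mem (hm₁ 5 (by decide)) (hm₁ 6 (by decide))
        (hrow.congr fun z => (hle_out x (hxO.2 hio) z).symm) hother⟩
    · have hxO' : x ∉ O := fun h => by have := hxO.1 h; omega
      have hxS : x ∈ S := (hmemS x).2 hxO'
      have hnotsd : x ∉ (L.take i).toFinset \ O := by simp [hxnot]
      rw [hins, Finset.insert_sdiff_of_notMem _ hxO', Finset.sum_insert hnotsd]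
      have hin₁ : Input adj inp out s₁ :=
        hin'.of_frame (p := .seq (.assign 4 (.lit 0)) (.store 7 (.lit 0) (.lit 0)))
          ⟨fun r hr => by simp_all [Prog.regs], fun a ha => by simp_all [Prog.arrays]⟩ (by decide)
      refine (WP.closeRow (x := x) (v := F x) (le := le) hS hin₁ (by simp [hs₁])
        (by rw [hm₁ 4 (by decide)]; exact hst.succ x hxS) (hst.sched.succ_ne hxS) hrow ?_
        (by rw [hm₁ 6 (by decide)]; exact hpos) (hle x hxO')).conseq ?_
      · intro y hy hyx
        have hyL : y ∈ L.take i := by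
          refine Stage.mem_take_of_step hS hst.sched hiL hio ?_ (by rwa [← hxdef])
          rw [← hxdef]
          exact hy.imp_right fun h => ((hS.mem_adj _ _).1 h).symm
        exact (hrows y hyL).of_eq (by rw [hm₁ 5 (by decide), hm 5 (by decide)])
          (by rw [hm₁ 6 (by decide), hm 6 (by decide)]) (hother y hyx)
      · rintro t₂ s₂ hF₂ ⟨ht₂, hrow₂, hother₂⟩
        have hexp : (43 * inp.length + 23) * ((adj (F x)).length + 1 +
            ∑ x ∈ (L.take i).toFinset \ O, ((adj (F x)).length + 1)) =
            (43 * inp.length + 17) * (adj (F x)).length + 6 * (adj (F x)).length +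
              43 * inp.length + 23 + (43 * inp.length + 23) *
                ∑ x ∈ (L.take i).toFinset \ O, ((adj (F x)).length + 1) := by ring
        rw [hexp]
        refine ⟨by omega, hnext s₂.mem (by rw [hF₂.mem 5 (by decide), hm₁ 5 (by decide)])
          (by rw [hF₂.mem 6 (by decide), hm₁ 6 (by decide)]) hrow₂ fun z hz q hq =>
          (hother₂ z hz q hq).trans (hother z hz q hq)⟩
  · rintro t s' hF hr ⟨ht, hrows, -⟩
    have htake : L.take n = L := List.take_of_length_le (by omega)
    rw [htake] at ht hrows
    have hLS : L.toFinset \ O = S.toFinset := by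
      ext x
      simp [hLmem x, hmemS]
    have hsum := hS.sum_length
    have h₁ : ∑ x ∈ S.toFinset, ((adj (F x)).length + 1) ≤
        2 * G.edgeSet.ncard + (n - inp.length) := by
      rw [Finset.sum_add_distrib, Finset.sum_const, smul_eq_mul, mul_one,
        List.toFinset_card_of_nodup hst.sched.nodup, ← hsum]
      refine Nat.add_le_add ?_ (by omega)
      rw [← Finset.sum_image (f := fun x => (adj x).length) (g := F)]
      · exact Finset.sum_le_sum_of_subset (Finset.subset_univ _)
      · intro x hx y hy
        exact hst.sched.injOn (by simpa using hx) (by simpa using hy)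
    rw [hLS] at ht
    have h₂ := Nat.mul_le_mul_left (43 * inp.length + 23) h₁
    exact ⟨by omega, fun x => hrows x (hLmem x)⟩

/-! ### The algorithm -/

theorem naturalLE_of_mem_out {f : {x : Fin n // x ∉ O} → {x : Fin n // x ∉ I}} {x : Fin n}
    (hx : x ∈ O) (z : Fin n) : naturalLE G I O f x z ↔ z = x := by
  constructor
  · intro h
    rcases Relation.ReflTransGen.cases_head h with h | ⟨_, ⟨h, -⟩, -⟩
    · exact h.symm
    · exact (h hx).elim
  · rintro rfl
    exact .refl

theorem naturalLE_of_notMem_out (hS : Setting W G I O adj inp out)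
    {f : {x : Fin n // x ∉ O} → {x : Fin n // x ∉ I}} {x v : Fin n} (hx : x ∉ O)
    (hv : v = f ⟨x, hx⟩) (hvx : v ≠ x) (z : Fin n) : naturalLE G I O f x z ↔
      z = x ∨ naturalLE G I O f v z ∨ ∃ y ∈ adj v, y ≠ x ∧ naturalLE G I O f y z := by
  constructor
  · intro h
    -- after its last visit to `x`, a chain continues with `v` or with a neighbour of `v`
    have key : ∀ w, naturalLE G I O f w z → w = x →
        z = x ∨ naturalLE G I O f v z ∨ ∃ y ∈ adj v, y ≠ x ∧ naturalLE G I O f y z := by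
      intro w hw
      induction hw using Relation.ReflTransGen.head_induction_on with
      | refl => exact .inl
      | @head w y hwy hyz ih =>
        rintro rfl
        obtain ⟨_, hwy⟩ := hwy
        by_cases hyw : y = w
        · exact ih hyw
        · rw [← hv] at hwy
          rcases hwy with rfl | hwy
          · exact .inr (.inl hyz)
          · exact .inr (.inr ⟨y, (hS.mem_adj v y).2 hwy.symm, hyw, hyz⟩)
    exact key x h rfl
  · rintro (rfl | h | ⟨y, hy, -, h⟩)
    · exact .refl
    · exact .head ⟨hx, .inl hv⟩ h
    · exact .head ⟨hx, .inr (hv ▸ ((hS.mem_adj v y).1 hy).symm)⟩ h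

/-- Report that there is no flow. -/
def reject : Prog := .assign 0 (.lit 0)

/-- Try to schedule all vertices, and compute the output if this succeeds. -/
def search : Prog :=
  .seq flagInputs <|
  .seq markOutputs <|
  .seq stages <|
  .ite (.lt (.reg 8) (.reg 0)) reject <|
  .seq labelPaths <|
  .seq fillTable <|
  .assign 0 (.lit 1)

/-- The output of the algorithm is correct. -/
def Correct (G : SimpleGraph (Fin n)) (I O : Finset (Fin n)) (inp : List (Fin n)) (s : State) :
    Prop :=
  (HasFlow G I O → s.reg 0 = 1 ∧ ∃ f : {x : Fin n // x ∉ O} → {x : Fin n // x ∉ I},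
    IsFlow G I O f (naturalLE G I O f) ∧ HoldsFlow I O inp s f (naturalLE G I O f)) ∧
  (¬ HasFlow G I O → s.reg 0 = 0)

theorem holdsFlow_of_row (hS : Setting W G I O adj inp out) (hsch : Schedule G I O F S)
    (hlen : inp.length + S.length = n) (hcov : ∀ x, x ∉ O → x ∈ S) {s : State}
    (h4 : ∀ x ∈ S, s.mem 4 x = F x) (hL : Labelled inp F S s.mem)
    {le : Fin n → Fin n → Prop} (hrow : ∀ x, Row inp s.mem x (le x)) :
    HoldsFlow I O inp s (hsch.toFun hcov) le where
  succ x := h4 x (hcov x x.2)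
  path_lt := hL.path_lt
  path_start p := hL.start p p.2
  path_succ x := hL.step x (hcov x x.2)
  table_some x p y := (hrow x p p.2).eq_succ_iff
    (fun _ _ h5 h6 => hL.injective hS hsch hlen h5 h6) y
  table_none x p := (hrow x p p.2).eq_zero_iff

theorem WP.reject {s : State} (hW : 0 < W) (h : ¬ HasFlow G I O) :
    WP W reject s fun t s' => t ≤ 2 ∧ Correct G I O inp s' := by
  unfold RAM.reject
  rw [WP.assign_iff]
  simp only [Expr.Fits, Expr.cost, Expr.val_lit]
  exact ⟨by omega, by omega, fun h' => (h h').elim, fun _ => by simp⟩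

theorem WP.search (hS : Setting W G I O adj inp out) {s : State} (hin : Input adj inp out s)
    (hzero : ∀ a, 4 ≤ a → s.mem a = fun _ => 0) (hn : n ≤ G.edgeSet.ncard + inp.length)
    (hm : G.edgeSet.ncard ≤ inp.length * n) :
    WP W search s fun t s' =>
      t ≤ 500 * (inp.length * G.edgeSet.ncard + inp.length + 1) ∧ Correct G I O inp s' := by
  have hword := hS.word
  have hpos : 0 < n → 0 < inp.length := by
    intro h
    by_contra hk0
    have h0 : inp.length = 0 := by omega
    rw [h0] at hn hm
    omega
  unfold RAM.search
  rw [WP.seq_iff]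
  refine (WP.flagInputs hS hin (hzero 11 (by decide))).conseq ?_
  rintro t₁ s₁ hF₁ ⟨ht₁, h11⟩
  have hin₁ := hin.of_frame hF₁ (by decide)
  rw [WP.seq_iff]
  refine (WP.markOutputs hS hin₁ (by rw [hF₁.mem 8 (by decide), hzero 8 (by decide)])
    (by rw [hF₁.mem 9 (by decide), hzero 9 (by decide)])).conseq ?_
  rintro t₂ s₂ hF₂ ⟨ht₂, hM, hout⟩
  have hin₂ := hin₁.of_frame hF₂ (by decide)
  have hst₂ : Stage G I O adj inp out id [] s₂.mem := by
    have hlo := hS.length_out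
    refine ⟨.nil, by simp, by simpa using hM, fun p hp => ?_, fun v hv => ?_, fun x => ?_,
      fun i hi => (hout i hi).2, by simp⟩
    · exact ⟨out[p], (hout p (by omega)).1, .inr ((hS.mem_out _).1 (List.getElem_mem _))⟩
    · obtain ⟨p, hp, rfl⟩ := List.getElem_of_mem ((hS.mem_out v).2 (by simpa using hv))
      exact .inl ⟨p, by omega, (hout p hp).1⟩
    · rw [hF₂.mem 11 (by decide)]; exact h11 x
  rw [WP.seq_iff]
  refine (WP.stages hS hin₂ hst₂).conseq ?_
  rintro t₃ s₃ hF₃ ⟨F, S, ht₃, hst₃, h8, hle, hfl⟩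
  have hin₃ := hin₂.of_frame hF₃ (by decide)
  have h0 := hin₃.reg0
  have hz₃ : ∀ a, a ∈ [5, 6, 7] → s₃.mem a = fun _ => 0 := by
    intro a ha
    have h₁ : ∀ a ∈ [5, 6, 7], a ∉ RAM.flagInputs.arrays ∧ a ∉ RAM.markOutputs.arrays ∧
      a ∉ RAM.stages.arrays ∧ 4 ≤ a := by decide
    obtain ⟨h₂, h₃, h₄, h₅⟩ := h₁ a ha
    rw [hF₃.mem a h₄, hF₂.mem a h₃, hF₁.mem a h₂, hzero a h₅]
  -- all terms of the running time are bounded by multiples of `k * m`, `k` and `1`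
  have hd : n - inp.length ≤ G.edgeSet.ncard := by omega
  have hkm : G.edgeSet.ncard ≤ inp.length * G.edgeSet.ncard := by
    rcases Nat.eq_zero_or_pos inp.length with h | h
    · rw [h] at hm ⊢; omega
    · exact Nat.le_mul_of_pos_left _ h
  have hkd := Nat.mul_le_mul_left inp.length hd
  have ht₃' : (n - inp.length) * (38 * inp.length + 68) =
      38 * (inp.length * (n - inp.length)) + 68 * (n - inp.length) := by ring
  rw [ht₃'] at ht₃
  simp only [WP.ite_iff, Expr.Fits, Expr.val_reg, Expr.cost, Expr.val_lt_ne_zero_iff,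
    Expr.val_lt_eq_zero_iff, h0, h8]
  refine ⟨by omega, fun hlt => ?_, fun hge => ?_⟩
  · have hno : ¬ HasFlow G I O := hfl.resolve_left (by omega)
    refine (WP.reject (inp := inp) (by omega) hno).conseq ?_
    rintro t s' - ⟨ht, hc⟩
    exact ⟨by omega, hc⟩
  · have hlen : inp.length + S.length = n := by omega
    have hcov : ∀ x, x ∉ O → x ∈ S := fun x => (Stage.mem_sched_iff hS hst₃.sched hlen x).2
    have hflow := hst₃.sched.isFlow hcov
    rw [WP.seq_iff]
    refine (WP.labelPaths hS hin₃ hst₃ hlen hpos (hz₃ 5 (by decide)) (hz₃ 6 (by decide))).conseq ?_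
    rintro t₄ s₄ hF₄ ⟨ht₄, hL⟩
    have hin₄ := hin₃.of_frame hF₄ (by decide)
    have hst₄ : Stage G I O adj inp out F S s₄.mem := by
      refine ⟨hst₃.sched, ?_, ⟨?_, ?_⟩, ?_, ?_, ?_, ?_, ?_⟩
      · rw [hF₄.mem 4 (by decide)]; exact hst₃.succ
      · rw [hF₄.mem 8 (by decide)]; exact hst₃.marked.flag
      · rw [hF₄.mem 9 (by decide)]; exact hst₃.marked.count
      · rw [hF₄.mem 10 (by decide)]; exact hst₃.front
      · rw [hF₄.mem 10 (by decide)]; exact hst₃.front_or_used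
      · rw [hF₄.mem 11 (by decide)]; exact hst₃.isInp
      · rw [hF₄.mem 12 (by decide)]; exact hst₃.ord_out
      · rw [hF₄.mem 12 (by decide)]; exact hst₃.ord
    rw [WP.seq_iff]
    refine (WP.fillTable (le := naturalLE G I O (hst₃.sched.toFun hcov)) hS hin₄ hst₄ hlen hL
      (by rw [hF₄.mem 7 (by decide), hz₃ 7 (by decide)])
      (fun x hx => naturalLE_of_mem_out hx)
      (fun x hx => naturalLE_of_notMem_out hS hx rfl (hst₃.sched.succ_ne (hcov x hx)))).conseq ?_
    rintro t₅ s₅ hF₅ ⟨ht₅, hrow⟩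
    have ht₅' : (43 * inp.length + 23) * (2 * G.edgeSet.ncard + (n - inp.length)) =
        86 * (inp.length * G.edgeSet.ncard) + 43 * (inp.length * (n - inp.length)) +
          46 * G.edgeSet.ncard + 23 * (n - inp.length) := by ring
    rw [ht₅'] at ht₅
    rw [WP.assign_iff]
    simp only [Expr.Fits, Expr.cost, Expr.val_lit]
    refine ⟨by omega, by omega, fun _ => ⟨by simp, _, hflow, ?_⟩, fun h => (h ⟨_, _, hflow⟩).elim⟩
    refine holdsFlow_of_row hS hst₃.sched hlen hcov ?_ ⟨?_, ?_, ?_, ?_⟩ hrow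
    · rw [State.setReg_mem, hF₅.mem 4 (by decide)]; exact hst₄.succ
    · rw [State.setReg_mem, hF₅.mem 5 (by decide)]; exact hL.path_lt
    · rw [State.setReg_mem, hF₅.mem 6 (by decide)]; exact hL.pos_le
    · rw [State.setReg_mem, hF₅.mem 5 (by decide), hF₅.mem 6 (by decide)]; exact hL.start
    · rw [State.setReg_mem, hF₅.mem 5 (by decide), hF₅.mem 6 (by decide)]; exact hL.step

/-- The algorithm.  The cell `n` of array `0` holds twice the number of edges; a graph with too few
or too many edges is rejected in constant time. -/
def findFlow : Prog :=
  .seq (.assign 2 (.load 0 (.reg 0))) <|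
  .ite (.lt (.reg 2) (.mul (.lit 2) (.sub (.reg 0) (.reg 1)))) reject <|
  .ite (.lt (.mul (.lit 2) (.mul (.reg 1) (.reg 0))) (.reg 2)) reject search

theorem WP.findFlow (hS : Setting W G I O adj inp out) :
    WP W findFlow (initialState adj inp out) fun t s' =>
      t ≤ 600 * (inp.length * G.edgeSet.ncard + inp.length + 1) ∧
      t ≤ 1200 * (inp.length ^ 2 * n + 1) ∧ Correct G I O inp s' := by
  have hin := input_initialState adj inp out
  set s := initialState adj inp out with hs
  have hword := hS.word
  have hk := hS.length_inp_le
  have hL := hin.start n le_rfl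
  rw [startPos_self, hS.sum_length] at hL
  have hmn := hS.startPos_le n
  rw [startPos_self, hS.sum_length] at hmn
  have hkn : inp.length * n ≤ n * n := Nat.mul_le_mul_right n hk
  have h1 := hin.reg1
  have h0 := hin.reg0
  have hneg : (G.edgeSet.ncard < n - inp.length ∨ inp.length * n < G.edgeSet.ncard) →
      ¬ HasFlow G I O := by
    rintro hm ⟨f, le, hf⟩
    have h₁ := hf.card_le
    have h₂ := hf.edges_le
    rw [hS.card_out_eq, Fintype.card_fin] at h₁ h₂
    omega
  have hin₁ : Input adj inp out (s.setReg 2 (2 * G.edgeSet.ncard)) :=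
    hin.of_frame (p := .assign 2 (.lit 0))
      ⟨fun r hr => by simp_all [Prog.regs], fun _ _ => rfl⟩ (by decide)
  unfold RAM.findFlow
  simp only [WP.seq_iff, WP.assign_iff, WP.ite_iff, Expr.Fits, Expr.val_reg, Expr.val_load,
    Expr.val_sub, Expr.val_mul, Expr.val_lit, Expr.cost, h0, h1, hL, State.setReg_reg, if_pos,
    if_false, OfNat.zero_ne_ofNat, OfNat.one_ne_ofNat, Expr.val_lt_ne_zero_iff,
    Expr.val_lt_eq_zero_iff]
  refine ⟨by omega, by omega, fun hlt => ?_, fun hge => ⟨by omega, fun hlt => ?_, fun hge' => ?_⟩⟩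
  · refine (WP.reject (inp := inp) (by omega) (hneg (.inl (by omega)))).conseq ?_
    rintro t s' - ⟨ht, hc⟩
    exact ⟨by omega, by omega, hc⟩
  · refine (WP.reject (inp := inp) (by omega) (hneg (.inr (by omega)))).conseq ?_
    rintro t s' - ⟨ht, hc⟩
    exact ⟨by omega, by omega, hc⟩
  · refine (WP.search hS hin₁ (fun a ha => ?_) (by omega) (by omega)).conseq ?_
    · rw [State.setReg_mem, hs]
      obtain ⟨b, rfl⟩ : ∃ b, a = b + 4 := ⟨a - 4, by omega⟩
      rfl
    · rintro t s' - ⟨ht, hc⟩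
      have h₁ : inp.length * G.edgeSet.ncard ≤ inp.length ^ 2 * n := by
        rw [pow_two, mul_assoc]
        exact Nat.mul_le_mul_left _ (by omega)
      have h₂ : inp.length ≤ inp.length ^ 2 * n := by
        rcases Nat.eq_zero_or_pos inp.length with h | h
        · omega
        · exact (Nat.le_self_pow two_ne_zero _).trans (Nat.le_mul_of_pos_right _ (by omega))
      exact ⟨by omega, by omega, hc⟩

end RAM

theorem mainTheorem3 :
    ∃ (P : RAM.Prog) (C d : ℕ),
      ∀ (n k : ℕ) (G : SimpleGraph (Fin n)) (I O : Finset (Fin n))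
        (adj : Fin n → List (Fin n)) (inp out : List (Fin n)),
        I.card = k → O.card = k → IsPresentation G I O adj inp out →
        ∃ (t : ℕ) (s : RAM.State),
          RAM.Exec ((n + 2) ^ d) P (initialState adj inp out) t s ∧
          t ≤ C * (k * G.edgeSet.ncard + k + 1) ∧
          t ≤ C * (k ^ 2 * n + 1) ∧
          (HasFlow G I O → s.reg 0 = 1 ∧
            ∃ f : {x : Fin n // x ∉ O} → {x : Fin n // x ∉ I},
              IsFlow G I O f (naturalLE G I O f) ∧
              HoldsFlow I O inp s f (naturalLE G I O f)) ∧
          (¬ HasFlow G I O → s.reg 0 = 0) := by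
  -- all numbers are at most `4 n ^ 2 + 4 n + 9`, which is below `(n + 2) ^ 4`
  refine ⟨RAM.findFlow, 1200, 4, ?_⟩
  intro n k G I O adj inp out hI hO hP
  have hcI := hP.card_inp
  have hcO := hP.card_out
  have hS : RAM.Setting ((n + 2) ^ 4) G I O adj inp out := by
    refine ⟨hP, by omega, ?_⟩
    have : (n + 2) ^ 4 = n ^ 4 + 8 * n ^ 3 + 24 * (n * n) + 32 * n + 16 := by ring
    rw [this]
    omega
  obtain ⟨t, s, he, ht, ht', hc⟩ := RAM.WP.findFlow hS
  have hk : inp.length = k := by omega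
  rw [hk] at ht ht'
  exact ⟨t, s, he, by omega, ht', hc⟩
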